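/- Let $M$ be a compact connected complex manifold (Hausdorff, without boundary) of complex dimension at least $2$, with a locally conformally Kähler (lcK) structure $(\omega,\theta)$: $\omega$ is the $(1,1)$-form of a smooth Hermitian metric, the Lee form $\theta$ is a smooth closed $1$-form, and $d\omega=\theta\wedge\omega$. Let $\lambda\in\mathbb C\setminus\{0\}$ with $|\lambda|\neq 1$, let $H^\infty_\lambda=(\ell^2(\mathbb C)\setminus\{0\})/\langle\lambda\cdot\mathrm{id}\rangle$ be the infinite-dimensional classical Hopf manifold, with the form $\omega_H=\|z\|^{-2}\omega_0$, where $\omega_0=dd^c\|z\|^2$ is the form of the flat metric and $dd^c=\frac{\sqrt{-1}}2\partial\bar\partial$, and let $F\colon M\to H^\infty_\lambda$ be a global lcK immersion, i.e. a holomorphic map with $F^*\omega_H=\omega$. A Kähler covering of $M$ is a connected holomorphic Galois covering $\pi\colon\tilde M\to M$ with a smooth function $h$ on $\tilde M$ such that $\pi^*\theta=dh$; its Kähler form is $\tilde\omega=e^{-h}\pi^*\omega$. Its homothety character is the homomorphism $\chi$ from the deck transformation group $\Gamma$ to $\mathbb R^{>0}$ given by $\gamma^*\tilde\omega=\chi(\gamma)\tilde\omega$;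 the covering is minimal if $\chi$ is injective. The lcK rank is the rank of the abelian group $\mathrm{im}\,\chi$. A positive automorphic potential is a smooth function $\psi>0$ on $\tilde M$ with $dd^c\psi=\tilde\omega$ and $\gamma^*\psi=\chi(\gamma)\psi$ for all $\gamma\in\Gamma$; it is proper if $\psi\colon\tilde M\to(0,\infty)$ is a proper map. The homothety character of $H^\infty_\lambda$ is $\chi_0\colon\mathbb Z\to\mathbb R^{>0}$, $\chi_0(k)=|\lambda|^{2k}$, so that $(\lambda^k\cdot\mathrm{id})^*\omega_0=\chi_0(k)\,\omega_0$. Then $(M,\omega)$ admits a proper positive automorphic potential, induced by $F$. More precisely: 1. There are a minimal Kähler covering $\tilde M$ of $M$ and a holomorphic lift $\tilde F\colon\tilde M\to\ell^2(\mathbb C)\setminus\{0\}$ of $F$ such that $\psi=\|\tilde F\|^2$ is a positive automorphic potential of $\tilde\omega$ and is proper; its homothety character $\chi$ satisfies $\mathrm{im}\,\chi\subseteq\mathrm{im}\,\chi_0$, and the lcK rank is $1$. 2. For every Kähler covering $(\pi\colon\tilde M\to M,h)$, the homothety character $\chi$ exists, $\mathrm{im}\,\chi\subseteq\mathrm{im}\,\chi_0$,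 and the lcK rank is $1$. Moreover $F$ has a holomorphic lift $\tilde F\colon\tilde M\to\ell^2(\mathbb C)\setminus\{0\}$ for which $\pi^*\omega=\|\tilde F\|^{-2}dd^c\|\tilde F\|^2$, and there is a constant $c>0$ such that $c\,\|\tilde F\|^2$ is a positive automorphic potential of $\tilde\omega$; this potential is proper if the covering is minimal. -/

import Mathlib

open scoped Manifold ContDiff Topology

universe u v w

noncomputable section

/-! ### Differential forms on manifolds modelled on a complex normed space -/

section Forms

variable {E : Type*} [NormedAddCommGroup E] [NormedSpace ℂ E]
  {M : Type*} [TopologicalSpace M] [ChartedSpace E M]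
  {E' : Type*} [NormedAddCommGroup E'] [NormedSpace ℂ E']
  {N : Type*} [TopologicalSpace N] [ChartedSpace E' N]

/-- Real differential `k`-forms on `M` (no smoothness required). The real tangent space
`TangentSpace 𝓘(ℝ, E) x` is by definition `E`, a tangent vector being represented in the
preferred chart `chartAt E x`. As the charts of a complex manifold are holomorphic, the complex
structure `J` of the tangent space is multiplication by `Complex.I`. -/
abbrev DiffForm (E : Type*) [NormedAddCommGroup E] [NormedSpace ℂ E] (M : Type*) (k : ℕ) :
    Type _ :=
  M → E [⋀^Fin k]→L[ℝ] ℝ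

/-- The pullback `f^* Ω` of a differential form by a (real differentiable) map. -/
def DiffForm.pullback {k : ℕ} (f : N → M) (Ω : DiffForm E M k) : DiffForm E' N k :=
  fun y => (Ω (f y)).compContinuousLinearMap
    (mfderiv 𝓘(ℝ, E') 𝓘(ℝ, E) f y : E' →L[ℝ] E)

/-- A form is smooth if it has smooth coefficients in all charts. -/
def DiffForm.Smooth {k : ℕ} (Ω : DiffForm E M k) : Prop :=
  ∀ e ∈ atlas E M, ContDiffOn ℝ ∞ (DiffForm.pullback (E' := E) (e.symm : E → M) Ω) e.target

/-- The exterior derivative, computed at `x` in the preferred chart at `x`. -/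
def DiffForm.d {k : ℕ} (Ω : DiffForm E M k) : DiffForm E M (k + 1) :=
  fun x => extDeriv (DiffForm.pullback (E' := E) ((chartAt E x).symm : E → M) Ω) (chartAt E x x)

/-- The differential of a real function, as a `1`-form. -/
def differential (E : Type*) [NormedAddCommGroup E] [NormedSpace ℂ E] {M : Type*}
    [TopologicalSpace M] [ChartedSpace E M] (f : M → ℝ) : DiffForm E M 1 :=
  fun x => ContinuousAlternatingMap.ofSubsingleton ℝ E ℝ (0 : Fin 1)
    (mfderiv 𝓘(ℝ, E) 𝓘(ℝ, ℝ) f x : E →L[ℝ] ℝ)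

/-- The complex structure on tangent vectors. -/
def complexStructure (E : Type*) [NormedAddCommGroup E] [NormedSpace ℂ E] : E →L[ℝ] E :=
  (Complex.I • ContinuousLinearMap.id ℂ E).restrictScalars ℝ

/-- The operator `d^c = (√-1/4) (∂̄ - ∂)`, i.e. `d^c f (v) = - df (J v) / 4`. It is normalised so
that `d d^c = (√-1/2) ∂ ∂̄`. -/
def dc (E : Type*) [NormedAddCommGroup E] [NormedSpace ℂ E] {M : Type*}
    [TopologicalSpace M] [ChartedSpace E M] (f : M → ℝ) : DiffForm E M 1 :=
  fun x => (-(1 / 4 : ℝ)) • (differential E f x).compContinuousLinearMap (complexStructure E)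

/-- The real `(1,1)`-form `d d^c f = (√-1/2) ∂ ∂̄ f`. -/
def ddc (E : Type*) [NormedAddCommGroup E] [NormedSpace ℂ E] {M : Type*}
    [TopologicalSpace M] [ChartedSpace E M] (f : M → ℝ) : DiffForm E M 2 :=
  (dc E f).d

/-- `(Ω, θ)` is a locally conformally Kähler structure on the complex manifold `M`: `Ω` is the
`(1,1)`-form of a Hermitian metric `g` (`Ω(v, w) = g(Jv, w)`, so `g(v, w) = Ω(v, Jw)`), `θ` is a
closed `1`-form, the Lee form, and `dΩ = θ ∧ Ω`. -/
structure IsLCK (Ω : DiffForm E M 2) (θ : DiffForm E M 1) : Prop where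
  smooth_form : Ω.Smooth
  smooth_lee : θ.Smooth
  type_one_one : ∀ (x : M) (v w : E), Ω x ![Complex.I • v, Complex.I • w] = Ω x ![v, w]
  pos : ∀ (x : M) (v : E), v ≠ 0 → 0 < Ω x ![v, Complex.I • v]
  lee_closed : θ.d = 0
  d_form : ∀ (x : M) (v₀ v₁ v₂ : E), Ω.d x ![v₀, v₁, v₂] =
    θ x ![v₀] * Ω x ![v₁, v₂] - θ x ![v₁] * Ω x ![v₀, v₂] + θ x ![v₂] * Ω x ![v₀, v₁]

end Forms

/-! ### Classical Hopf manifolds of finite or infinite dimension -/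

/-- The complex numbers `l ≠ 0` with `|l| ≠ 1`. -/
structure HopfParameter where
  val : ℂ
  ne_zero : val ≠ 0
  norm_ne_one : ‖val‖ ≠ 1

section Hopf

variable (V : Type*) [NormedAddCommGroup V] [InnerProductSpace ℂ V] (l : HopfParameter)

/-- The orbit relation on `V \ {0}` of the group generated by `l • id`. -/
def hopfSetoid : Setoid {z : V // z ≠ 0} where
  r z z' := ∃ k : ℤ, (z' : V) = l.val ^ k • (z : V)
  iseqv :=
    { refl := fun z => ⟨0, by simp⟩
      symm := by
        rintro z z' ⟨k, hk⟩
        refine ⟨-k, ?_⟩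
        rw [hk, smul_smul, ← zpow_add₀ l.ne_zero]
        simp
      trans := by
        rintro z z' z'' ⟨k, hk⟩ ⟨m, hm⟩
        refine ⟨m + k, ?_⟩
        rw [hm, hk, smul_smul, ← zpow_add₀ l.ne_zero] }

/-- The classical Hopf manifold `(V \ {0}) / ⟨l • id⟩`. -/
def HopfManifold : Type _ := Quotient (hopfSetoid V l)

/-- The Hopf manifold carries the quotient topology. -/
instance : TopologicalSpace (HopfManifold V l) :=
  inferInstanceAs (TopologicalSpace (Quotient (hopfSetoid V l)))

variable {V}

/-- The quotient map `V \ {0} → (V \ {0}) / ⟨l • id⟩`. -/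
def hopfMk (z : {z : V // z ≠ 0}) : HopfManifold V l := Quotient.mk (hopfSetoid V l) z

variable {l}

/-- `z` is a nonzero vector representing the point `p` of the Hopf manifold. -/
def IsHopfLift (z : V) (p : HopfManifold V l) : Prop := ∃ hz : z ≠ 0, hopfMk l ⟨z, hz⟩ = p

/-- A chart of the Hopf manifold which is a local section of the quotient map. -/
def IsHopfChart (e : OpenPartialHomeomorph (HopfManifold V l) V) : Prop :=
  ∀ p ∈ e.source, IsHopfLift (e p) p

theorem hopfMk_eq_iff (z z' : {z : V // z ≠ 0}) :
    hopfMk l z = hopfMk l z' ↔ ∃ k : ℤ, (z' : V) = l.val ^ k • (z : V) := by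
  unfold hopfMk
  exact Quotient.eq (r := hopfSetoid V l)

theorem continuous_hopfMk : Continuous (hopfMk l : {z : V // z ≠ 0} → HopfManifold V l) :=
  continuous_quot_mk

theorem isOpenMap_hopfMk : IsOpenMap (hopfMk l : {z : V // z ≠ 0} → HopfManifold V l) := by
  intro U hU
  change IsOpen (hopfMk l ⁻¹' (hopfMk l '' U))
  have h : hopfMk l ⁻¹' (hopfMk l '' U) = ⋃ k : ℤ,
      (fun z : {z : V // z ≠ 0} => (⟨l.val ^ k • (z : V),
        smul_ne_zero (zpow_ne_zero _ l.ne_zero) z.2⟩ : {z : V // z ≠ 0})) ⁻¹' U := by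
    ext z
    simp only [Set.mem_preimage, Set.mem_image, Set.mem_iUnion]
    constructor
    · rintro ⟨y, hy, hyz⟩
      obtain ⟨k, hk⟩ := (hopfMk_eq_iff z y).1 hyz.symm
      refine ⟨k, ?_⟩
      have : (⟨l.val ^ k • (z : V), smul_ne_zero (zpow_ne_zero _ l.ne_zero) z.2⟩ :
        {z : V // z ≠ 0}) = y := Subtype.ext hk.symm
      rwa [this]
    · rintro ⟨k, hk⟩
      exact ⟨_, hk, ((hopfMk_eq_iff z _).2 ⟨k, rfl⟩).symm⟩
  rw [h]
  refine isOpen_iUnion fun k => hU.preimage ?_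
  exact Continuous.subtype_mk (continuous_const.smul continuous_subtype_val) _

/-- A number `c > 1` such that `|l| ^ k` is within `(c⁻², c²)` only for `k = 0`. -/
theorem exists_hopf_gap (l : HopfParameter) :
    ∃ c : ℝ, 1 < c ∧ ∀ k : ℤ, (c ^ 2)⁻¹ < ‖l.val‖ ^ k → ‖l.val‖ ^ k < c ^ 2 → k = 0 := by
  have hpos : 0 < ‖l.val‖ := norm_pos_iff.2 l.ne_zero
  have key : ∀ r : ℝ, 1 < r → ∃ c : ℝ, 1 < c ∧
      ∀ k : ℤ, (c ^ 2)⁻¹ < r ^ k → r ^ k < c ^ 2 → k = 0 := by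
    intro r hr
    refine ⟨Real.sqrt r, by rw [Real.lt_sqrt (by norm_num)]; simpa using hr, ?_⟩
    intro k h1 h2
    rw [Real.sq_sqrt (by linarith)] at h1 h2
    have h1' : r ^ (-1 : ℤ) < r ^ k := by simpa using h1
    have h2' : r ^ k < r ^ (1 : ℤ) := by simpa using h2
    have := (zpow_lt_zpow_iff_right₀ hr).1 h1'
    have := (zpow_lt_zpow_iff_right₀ hr).1 h2'
    omega
  rcases lt_or_gt_of_ne l.norm_ne_one with h | h
  · obtain ⟨c, hc, hk⟩ := key ‖l.val‖⁻¹ ((one_lt_inv₀ hpos).2 h)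
    refine ⟨c, hc, fun k h1 h2 => ?_⟩
    have := hk (-k) (by simpa using h1) (by simpa using h2)
    omega
  · exact key _ h

/-- Every point of the Hopf manifold lies in the domain of a local section of the quotient map. -/
theorem exists_hopfChart (p : HopfManifold V l) :
    ∃ e : OpenPartialHomeomorph (HopfManifold V l) V, p ∈ e.source ∧ IsHopfChart e := by
  obtain ⟨z, rfl⟩ : ∃ z, hopfMk l z = p := Quotient.exists_rep p
  obtain ⟨c, hc, hgap⟩ := exists_hopf_gap l
  have hzpos : 0 < ‖(z : V)‖ := norm_pos_iff.2 z.2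
  have hc0 : 0 < c := by linarith
  let U : Set V := {y | c⁻¹ * ‖(z : V)‖ < ‖y‖ ∧ ‖y‖ < c * ‖(z : V)‖}
  have hU : IsOpen U :=
    (isOpen_lt continuous_const continuous_norm).inter
      (isOpen_lt continuous_norm continuous_const)
  have hzU : (z : V) ∈ U := by
    refine ⟨?_, ?_⟩
    · have : c⁻¹ < 1 := inv_lt_one_of_one_lt₀ hc
      nlinarith
    · nlinarith
  have hne : ∀ y ∈ U, y ≠ 0 := by
    rintro y hy rfl
    have h1 := hy.1
    rw [norm_zero] at h1
    have : 0 < c⁻¹ * ‖(z : V)‖ := by positivity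
    linarith
  have : Nonempty U := ⟨⟨z, hzU⟩⟩
  let i : U → {y : V // y ≠ 0} := fun y => ⟨y, hne y y.2⟩
  have hi : Topology.IsOpenEmbedding i := by
    refine Topology.IsOpenEmbedding.of_comp i
      (IsOpen.isOpenEmbedding_subtypeVal (isOpen_compl_singleton (x := (0 : V)))) ?_
    exact hU.isOpenEmbedding_subtypeVal
  let j : U → HopfManifold V l := fun y => hopfMk l (i y)
  have hj : Topology.IsOpenEmbedding j := by
    refine Topology.IsOpenEmbedding.of_continuous_injective_isOpenMap
      (continuous_hopfMk.comp hi.continuous) ?_ (isOpenMap_hopfMk.comp hi.isOpenMap)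
    intro y y' hyy
    obtain ⟨k, hk⟩ := (hopfMk_eq_iff (i y) (i y')).1 hyy
    have hk' : (y' : V) = l.val ^ k • (y : V) := hk
    have hn : ‖(y' : V)‖ = ‖l.val‖ ^ k * ‖(y : V)‖ := by rw [hk', norm_smul, norm_zpow]
    have hy1 := y.2.1
    have hy2 := y.2.2
    have hy1' := y'.2.1
    have hy2' := y'.2.2
    have hypos : 0 < ‖(y : V)‖ := norm_pos_iff.2 (hne y y.2)
    have hcc : c * c⁻¹ = 1 := mul_inv_cancel₀ hc0.ne'
    have hci : 0 < c⁻¹ := inv_pos.2 hc0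
    have hz1 : ‖(z : V)‖ < c * ‖(y : V)‖ := by
      have := mul_lt_mul_of_pos_left hy1 hc0
      rwa [← mul_assoc, hcc, one_mul] at this
    have hz2 : c⁻¹ * ‖(y : V)‖ < ‖(z : V)‖ := by
      have := mul_lt_mul_of_pos_left hy2 hci
      rwa [← mul_assoc, mul_comm c⁻¹ c, hcc, one_mul] at this
    have hk0 : k = 0 := by
      refine hgap k ?_ ?_
      · have h : (c ^ 2)⁻¹ * ‖(y : V)‖ < ‖l.val‖ ^ k * ‖(y : V)‖ := by
          rw [← hn]
          calc (c ^ 2)⁻¹ * ‖(y : V)‖ = c⁻¹ * (c⁻¹ * ‖(y : V)‖) := by rw [sq, mul_inv, mul_assoc]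
            _ < c⁻¹ * ‖(z : V)‖ := mul_lt_mul_of_pos_left hz2 hci
            _ < ‖(y' : V)‖ := hy1'
        exact lt_of_mul_lt_mul_right h hypos.le
      · have h : ‖l.val‖ ^ k * ‖(y : V)‖ < c ^ 2 * ‖(y : V)‖ := by
          rw [← hn]
          calc ‖(y' : V)‖ < c * ‖(z : V)‖ := hy2'
            _ < c * (c * ‖(y : V)‖) := mul_lt_mul_of_pos_left hz1 hc0
            _ = c ^ 2 * ‖(y : V)‖ := by ring
        exact lt_of_mul_lt_mul_right h hypos.le
    apply Subtype.ext
    rw [hk', hk0]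
    simp
  let e₁ := hj.toOpenPartialHomeomorph j
  let e₂ := hU.isOpenEmbedding_subtypeVal.toOpenPartialHomeomorph (Subtype.val : U → V)
  refine ⟨e₁.symm.trans e₂, ?_, ?_⟩
  · simp only [OpenPartialHomeomorph.trans_source, OpenPartialHomeomorph.symm_source, e₁, e₂,
      Topology.IsOpenEmbedding.toOpenPartialHomeomorph_target,
      Topology.IsOpenEmbedding.toOpenPartialHomeomorph_source, Set.preimage_univ, Set.inter_univ]
    exact ⟨⟨z, hzU⟩, rfl⟩
  · intro q hq
    simp only [OpenPartialHomeomorph.trans_source, OpenPartialHomeomorph.symm_source, e₁, e₂,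
      Topology.IsOpenEmbedding.toOpenPartialHomeomorph_target,
      Topology.IsOpenEmbedding.toOpenPartialHomeomorph_source, Set.preimage_univ,
      Set.inter_univ] at hq
    obtain ⟨y, rfl⟩ := hq
    have hy : (e₁.symm.trans e₂) (j y) = (y : V) := by
      have : e₁.symm (j y) = y := hj.toOpenPartialHomeomorph_left_inv j
      rw [OpenPartialHomeomorph.coe_trans, Function.comp_apply, this]
      rfl
    rw [hy]
    exact ⟨hne y y.2, rfl⟩

/-- The Hopf manifold as a manifold modelled on `V`: the charts are all the local sections of the
quotient map `V \ {0} → (V \ {0}) / ⟨l • id⟩`. -/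
instance : ChartedSpace V (HopfManifold V l) where
  atlas := {e | IsHopfChart e}
  chartAt p := (exists_hopfChart p).choose
  mem_chart_source p := (exists_hopfChart p).choose_spec.1
  chart_mem_atlas p := (exists_hopfChart p).choose_spec.2

/-- Two charts of the Hopf manifold differ locally by a power of `l`. -/
theorem hopf_transition {e e' : OpenPartialHomeomorph (HopfManifold V l) V}
    (he : IsHopfChart e) (he' : IsHopfChart e') {y : V} (hy : y ∈ (e.symm.trans e').source) :
    ∃ k : ℤ, ∀ᶠ x in 𝓝 y, e' (e.symm x) = l.val ^ k • x := by
  obtain ⟨c, hc, hgap⟩ := exists_hopf_gap l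
  have hc0 : 0 < c := by linarith
  have hlpos : 0 < ‖l.val‖ := norm_pos_iff.2 l.ne_zero
  have hk : ∀ x ∈ (e.symm.trans e').source, x ≠ 0 ∧ ∃ k : ℤ, e' (e.symm x) = l.val ^ k • x := by
    intro x hx
    rw [OpenPartialHomeomorph.trans_source] at hx
    have hx1 : x ∈ e.target := hx.1
    obtain ⟨h0, h1⟩ := he (e.symm x) (e.map_target hx1)
    obtain ⟨h0', h1'⟩ := he' (e.symm x) hx.2
    obtain ⟨k, hk⟩ := (hopfMk_eq_iff _ _).1 (h1.trans h1'.symm)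
    have hr : e (e.symm x) = x := e.right_inv hx1
    refine ⟨by rwa [hr] at h0, k, ?_⟩
    simpa [hr] using hk
  obtain ⟨hy0, k, hyk⟩ := hk y hy
  refine ⟨k, ?_⟩
  have hypos : 0 < ‖y‖ := norm_pos_iff.2 hy0
  let f : V → ℝ := fun x => ‖e' (e.symm x)‖ / ‖x‖ / ‖l.val‖ ^ k
  have hcont : ContinuousAt (fun x => e' (e.symm x)) y := (e.symm.trans e').continuousAt hy
  have hf : ContinuousAt f y :=
    (hcont.norm.div continuousAt_id.norm hypos.ne').div_const _
  have hf1 : f y = 1 := by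
    simp only [f, hyk, norm_smul, norm_zpow]
    have := zpow_pos hlpos k
    field_simp
  have hlo : (c ^ 2)⁻¹ < 1 := inv_lt_one_of_one_lt₀ (by nlinarith)
  have hhi : 1 < c ^ 2 := by nlinarith
  have e1 := hf.eventually (lt_mem_nhds (by rw [hf1]; exact hlo))
  have e2 := hf.eventually (gt_mem_nhds (by rw [hf1]; exact hhi))
  filter_upwards [e1, e2, (e.symm.trans e').open_source.mem_nhds hy] with x h1 h2 hx
  obtain ⟨hx0, m, hm⟩ := hk x hx
  have hxpos : 0 < ‖x‖ := norm_pos_iff.2 hx0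
  have hfx : f x = ‖l.val‖ ^ (m - k) := by
    simp only [f, hm, norm_smul, norm_zpow]
    rw [zpow_sub₀ hlpos.ne']
    field_simp
  rw [hfx] at h1 h2
  have := hgap (m - k) h1 h2
  have hmk : m = k := by omega
  rw [hm, hmk]

/-- The Hopf manifold is a complex manifold. -/
instance : IsManifold 𝓘(ℂ, V) ω (HopfManifold V l) := by
  refine isManifold_of_contDiffOn 𝓘(ℂ, V) ω (HopfManifold V l) ?_
  intro e e' he he'
  simp only [modelWithCornersSelf_coe, modelWithCornersSelf_coe_symm, Set.range_id,
    Set.preimage_id, Set.inter_univ, Function.id_comp, Function.comp_id]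
  intro y hy
  obtain ⟨k, hk⟩ := hopf_transition he he' hy
  refine ContDiffAt.contDiffWithinAt ?_
  exact (contDiffAt_id.const_smul (l.val ^ k)).congr_of_eventuallyEq hk

variable (V l)

/-- The constant `(1,1)`-form `ω₀(v, w) = g₀(Jv, w) = Im ⟪v, w⟫` of the flat metric
`g₀ = Re ⟪·, ·⟫` (the inner product is conjugate linear in the first variable). -/
def flatForm : V [⋀^Fin 2]→L[ℝ] ℝ where
  toFun v := (inner ℂ (v 0) (v 1)).im
  map_update_add' m i x y := by
    have hd : ‹DecidableEq (Fin 2)› = instDecidableEqFin 2 := Subsingleton.elim _ _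
    subst hd
    fin_cases i
    · simp
    · simp
  map_update_smul' m i c x := by
    have hd : ‹DecidableEq (Fin 2)› = instDecidableEqFin 2 := Subsingleton.elim _ _
    subst hd
    fin_cases i
    · simp [← Complex.coe_smul, mul_comm]
    · simp [← Complex.coe_smul]
  cont := by fun_prop
  map_eq_zero_of_eq' v i j hv hij := by
    have h01 : v 0 = v 1 := by
      fin_cases i <;> fin_cases j <;> simp_all
    rw [h01]
    exact inner_self_im (𝕜 := ℂ) _

/-- The form `ω_H = ‖z‖⁻² ω₀` on the Hopf manifold. The preferred chart `chartAt V p` is a local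
section of the quotient map, whose value at `p` is a representative `z` of `p`, and tangent vectors
at `p` are represented in this chart. -/
def hopfForm : DiffForm V (HopfManifold V l) 2 :=
  fun p => (‖chartAt V p p‖ ^ 2)⁻¹ • flatForm V

/-- The pullback of `ω_H` to `V \ {0}` is `‖z‖⁻² ω₀`. -/
theorem hopfForm_pullback {e : OpenPartialHomeomorph (HopfManifold V l) V}
    (he : e ∈ atlas V (HopfManifold V l)) {z : V} (hz : z ∈ e.target) :
    (hopfForm V l).pullback (E' := V) (e.symm : V → HopfManifold V l) z
      = (‖z‖ ^ 2)⁻¹ • flatForm V := by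
  set p := e.symm z with hp
  have hz' : z ∈ (e.symm.trans (chartAt V p)).source := by
    rw [OpenPartialHomeomorph.trans_source]
    exact ⟨hz, mem_chart_source V p⟩
  obtain ⟨k, hk⟩ := hopf_transition he (chart_mem_atlas V p) hz'
  have hder : mfderiv 𝓘(ℝ, V) 𝓘(ℝ, V) (e.symm : V → HopfManifold V l) z
      = (l.val ^ k • ContinuousLinearMap.id ℂ V).restrictScalars ℝ := by
    have h1 : HasFDerivAt (fun x => chartAt V p (e.symm x))
        ((l.val ^ k • ContinuousLinearMap.id ℂ V).restrictScalars ℝ) z := by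
      have h2 : HasFDerivAt (fun x : V => l.val ^ k • x)
          ((l.val ^ k • ContinuousLinearMap.id ℂ V).restrictScalars ℝ) z :=
        ((hasFDerivAt_id (𝕜 := ℂ) z).const_smul (l.val ^ k)).restrictScalars ℝ
      exact h2.congr_of_eventuallyEq hk
    refine HasMFDerivAt.mfderiv ⟨e.symm.continuousAt hz, ?_⟩
    simp only [writtenInExtChartAt, extChartAt, mfld_simps]
    exact h1.hasFDerivWithinAt
  have hval : chartAt V p p = l.val ^ k • z := hk.self_of_nhds
  have hl : 0 < ‖l.val‖ ^ k := zpow_pos (norm_pos_iff.2 l.ne_zero) k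
  ext v
  have hl2 : (starRingEnd ℂ) (l.val ^ k) * l.val ^ k = (((‖l.val‖ ^ k) ^ 2 : ℝ) : ℂ) := by
    rw [← norm_zpow, ← Complex.normSq_eq_conj_mul_self, Complex.normSq_eq_norm_sq]
  have key : flatForm V (fun i => l.val ^ k • v i) = (‖l.val‖ ^ k) ^ 2 * flatForm V v := by
    change (inner ℂ (l.val ^ k • v 0) (l.val ^ k • v 1)).im = _ * (inner ℂ (v 0) (v 1)).im
    rw [inner_smul_left, inner_smul_right, ← mul_assoc, hl2, Complex.im_ofReal_mul]
  have hpull : (hopfForm V l).pullback (E' := V) (e.symm : V → HopfManifold V l) z v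
      = (‖chartAt V p p‖ ^ 2)⁻¹ * flatForm V (fun i => l.val ^ k • v i) := by
    simp only [DiffForm.pullback, hopfForm, hder]
    rfl
  rw [hpull, key, hval, norm_smul, norm_zpow, mul_pow, mul_inv]
  change _ = (‖z‖ ^ 2)⁻¹ * flatForm V v
  field_simp

/-- The homothety character of the covering `V \ {0} → (V \ {0}) / ⟨l • id⟩`, on its deck group
`ℤ`: the deck transformation `z ↦ l ^ k • z` multiplies the flat form `ω₀` by `|l| ^ (2 k)`. -/
def hopfCharacter : Multiplicative ℤ →* {r : ℝ // 0 < r} :=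
  zpowersHom _ ⟨‖l.val‖ ^ 2, pow_pos (norm_pos_iff.2 l.ne_zero) 2⟩

/-- The factors `|l| ^ (2 k)` are the homothety factors of the deck transformations. -/
theorem hopfCharacter_apply (k : ℤ) (v w : V) :
    flatForm V ![l.val ^ k • v, l.val ^ k • w]
      = (hopfCharacter l (Multiplicative.ofAdd k) : ℝ) * flatForm V ![v, w] := by
  have hl2 : (starRingEnd ℂ) (l.val ^ k) * l.val ^ k = (((‖l.val‖ ^ k) ^ 2 : ℝ) : ℂ) := by
    rw [← norm_zpow, ← Complex.normSq_eq_conj_mul_self, Complex.normSq_eq_norm_sq]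
  have hc : (hopfCharacter l (Multiplicative.ofAdd k) : ℝ) = (‖l.val‖ ^ k) ^ 2 := by
    simp only [hopfCharacter, zpowersHom_apply, toAdd_ofAdd]
    rw [Positive.coe_zpow]
    change (‖l.val‖ ^ 2) ^ k = _
    rw [← zpow_natCast, ← zpow_natCast, ← zpow_mul, ← zpow_mul, mul_comm]
  change (inner ℂ (l.val ^ k • v) (l.val ^ k • w)).im = _ * (inner ℂ v w).im
  rw [inner_smul_left, inner_smul_right, ← mul_assoc, hl2, Complex.im_ofReal_mul, hc]

variable {V l} {E : Type*} [NormedAddCommGroup E] [NormedSpace ℂ E]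
  {M : Type*} [TopologicalSpace M] [ChartedSpace E M]

/-- A (global) lcK immersion of `(M, Ω)` into the Hopf manifold: a holomorphic (complex analytic)
map `F` with `F^* ω_H = Ω`. -/
structure IsLCKImmersion (Ω : DiffForm E M 2) (F : M → HopfManifold V l) : Prop where
  holomorphic : ContMDiff 𝓘(ℂ, E) 𝓘(ℂ, V) ω F
  pullback_eq : (hopfForm V l).pullback F = Ω

end Hopf

/-! ### Kähler coverings, homothety character, automorphic potentials -/

/-- The group of deck transformations of `π : Y → X`. -/
def deckGroup {Y X : Type*} [TopologicalSpace Y] (π : Y → X) : Subgroup (Y ≃ₜ Y) where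
  carrier := {γ | ∀ y, π (γ y) = π y}
  mul_mem' := by
    intro a b ha hb y
    exact (ha (b y)).trans (hb y)
  one_mem' := fun _ => rfl
  inv_mem' := by
    intro a ha y
    have h := ha (a⁻¹ y)
    rw [show a (a⁻¹ y) = y from a.apply_symm_apply y] at h
    exact h.symm

section Covering

variable {E : Type*} [NormedAddCommGroup E] [NormedSpace ℂ E]
  {M : Type*} [TopologicalSpace M] [ChartedSpace E M]

/-- A Kähler covering of an lcK manifold with Lee form `θ`: a connected holomorphic Galois covering
`π : M' → M` together with a smooth function `h` on `M'` such that `π^* θ = dh`. -/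
structure KahlerCovering (θ : DiffForm E M 1) where
  carrier : Type w
  [topology : TopologicalSpace carrier]
  [charts : ChartedSpace E carrier]
  [manifold : IsManifold 𝓘(ℂ, E) ω carrier]
  [hausdorff : T2Space carrier]
  [connected : ConnectedSpace carrier]
  proj : carrier → M
  covering : IsCoveringMap proj
  surjective : Function.Surjective proj
  localDiffeo : IsLocalDiffeomorph 𝓘(ℂ, E) 𝓘(ℂ, E) ω proj
  galois : ∀ y y', proj y = proj y' → ∃ γ ∈ deckGroup proj, γ y = y'
  pot : carrier → ℝ
  smooth_pot : ContMDiff 𝓘(ℝ, E) 𝓘(ℝ, ℝ) ∞ pot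
  d_pot : θ.pullback proj = differential E pot

attribute [instance] KahlerCovering.topology KahlerCovering.charts KahlerCovering.manifold
  KahlerCovering.hausdorff KahlerCovering.connected

namespace KahlerCovering

variable {θ : DiffForm E M 1} (K : KahlerCovering.{w} θ)

/-- The deck transformation group `Γ` of a Kähler covering. -/
abbrev Deck : Type w := deckGroup K.proj

/-- The Kähler form `exp(-h) π^* Ω` on the covering space. -/
def kahlerForm (Ω : DiffForm E M 2) : DiffForm E K.carrier 2 :=
  fun y => Real.exp (-K.pot y) • Ω.pullback K.proj y

/-- `χ` is the homothety character: `γ^* ω' = χ(γ) ω'` for the Kähler form `ω'` of the covering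
and all deck transformations `γ`. -/
def IsHomothetyCharacter (Ω : DiffForm E M 2) (χ : K.Deck →* {r : ℝ // 0 < r}) : Prop :=
  ∀ (γ : K.Deck), (K.kahlerForm Ω).pullback (γ : K.carrier ≃ₜ K.carrier)
    = fun y => (χ γ : ℝ) • K.kahlerForm Ω y

/-- `ψ` is a positive automorphic potential of the Kähler form `ω'` of the covering:
`ω' = d d^c ψ` and `γ^* ψ = χ(γ) ψ` for all deck transformations `γ`. -/
structure IsAutomorphicPotential (Ω : DiffForm E M 2) (χ : K.Deck →* {r : ℝ // 0 < r})
    (ψ : K.carrier → ℝ) : Prop where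
  smooth : ContMDiff 𝓘(ℝ, E) 𝓘(ℝ, ℝ) ∞ ψ
  pos : ∀ y, 0 < ψ y
  ddc_eq : ddc E ψ = K.kahlerForm Ω
  automorphic : ∀ (γ : K.Deck) (y : K.carrier),
    ψ ((γ : K.carrier ≃ₜ K.carrier) y) = (χ γ : ℝ) * ψ y

/-- The positive function `ψ` is proper as a map to the half-line `(0, ∞)`. -/
def IsProperPotential (ψ : K.carrier → ℝ) : Prop :=
  ∃ hψ : ∀ y, 0 < ψ y, IsProperMap (fun y => (⟨ψ y, hψ y⟩ : {r : ℝ // 0 < r}))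

/-- `F'` is a holomorphic lift, to the Kähler covering and to `V \ {0}`, of a map `F` into a Hopf
manifold. -/
structure IsHolomorphicLift {V : Type*} [NormedAddCommGroup V] [InnerProductSpace ℂ V]
    {l : HopfParameter} (F : M → HopfManifold V l) (F' : K.carrier → V) : Prop where
  holomorphic : ContMDiff 𝓘(ℂ, E) 𝓘(ℂ, V) ω F'
  lift : ∀ y, IsHopfLift (F' y) (F (K.proj y))

/-- The lcK rank: the rank of the image of the homothety character, an abelian group. -/
def lckRank {K : KahlerCovering.{w} θ} (χ : K.Deck →* {r : ℝ // 0 < r}) : Cardinal :=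
  Module.rank ℤ (Additive χ.range)

end KahlerCovering

end Covering

end

/-!
In dimension at least two, wedging with `ω` is injective on covectors. For a local lift `f` of `F`
to `V \ {0}` one has `ω = ‖f‖⁻² dd^c ‖f‖²`, so `dω = θ ∧ ω` forces `θ = -d log ‖f‖²`. Hence on any
covering with `π^*θ = dh` the function `exp h · ‖f‖²` is locally constant along local lifts. Two
lifts of a point differ by a power of `λ`, and `|λ| ≠ 1`, so prescribing the value of this constant
singles out one lift at each point. These fit together to a global holomorphic lift `F'`, and
`c ‖F'‖² = exp (-h)`.

Deck transformations act on `F'` by powers of `λ`, so the homothety character `χ` takes its values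
in the powers of `|λ|²`. If it were trivial, `‖F'‖²` would descend to the compact manifold `M` and
attain a maximum; but it is strictly plurisubharmonic. So the lcK rank is one. When `χ` is
injective, the potential multiplies along an orbit by distinct powers of `|λ|²`, which leave every
compact subset of `(0, ∞)`; since some compact set meets every orbit, the potential is proper.

A minimal covering is a connected component of the pullback of `V \ {0} → H` along `F`: there the
tautological lift of `F` separates the points of each fibre.
-/

universe t

noncomputable section

section RestrictScalars

variable (𝕜 : Type*) {𝕜' : Type*} [NontriviallyNormedField 𝕜] [NontriviallyNormedField 𝕜']
  [NormedAlgebra 𝕜 𝕜'] {E : Type*} [NormedAddCommGroup E] [NormedSpace 𝕜 E] [NormedSpace 𝕜' E]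
  [IsScalarTower 𝕜 𝕜' E] {M : Type*} [TopologicalSpace M] [ChartedSpace E M]
  {E' : Type*} [NormedAddCommGroup E'] [NormedSpace 𝕜 E'] [NormedSpace 𝕜' E']
  [IsScalarTower 𝕜 𝕜' E'] {N : Type*} [TopologicalSpace N] [ChartedSpace E' N]
  {n : WithTop ℕ∞} {f : M → N} {x : M}

theorem hasMFDerivAt_restrictScalars {f' : E →L[𝕜'] E'}
    (h : HasMFDerivAt 𝓘(𝕜', E) 𝓘(𝕜', E') f x f') :
    HasMFDerivAt 𝓘(𝕜, E) 𝓘(𝕜, E') f x (f'.restrictScalars 𝕜) :=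
  ⟨h.1, HasFDerivWithinAt.restrictScalars 𝕜 h.2⟩

theorem contMDiffAt_restrictScalars (h : ContMDiffAt 𝓘(𝕜', E) 𝓘(𝕜', E') n f x) :
    ContMDiffAt 𝓘(𝕜, E) 𝓘(𝕜, E') n f x := by
  rw [contMDiffAt_iff] at h ⊢
  exact ⟨h.1, ContDiffWithinAt.restrict_scalars 𝕜 h.2⟩

theorem contMDiff_restrictScalars (h : ContMDiff 𝓘(𝕜', E) 𝓘(𝕜', E') n f) :
    ContMDiff 𝓘(𝕜, E) 𝓘(𝕜, E') n f :=
  fun x => contMDiffAt_restrictScalars 𝕜 (h x)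

theorem isManifold_restrictScalars (h : IsManifold 𝓘(𝕜', E) n M) : IsManifold 𝓘(𝕜, E) n M := by
  refine isManifold_of_contDiffOn 𝓘(𝕜, E) n M fun e e' he he' => ?_
  have hcoord : e.symm.trans e' ∈ contDiffGroupoid n 𝓘(𝕜', E) := h.compatible he he'
  rw [contDiffGroupoid, mem_groupoid_of_pregroupoid] at hcoord
  exact ContDiffOn.restrict_scalars 𝕜 hcoord.1

end RestrictScalars

section Pullback

variable {E : Type*} [NormedAddCommGroup E] [NormedSpace ℂ E]
  {M : Type*} [TopologicalSpace M] [ChartedSpace E M]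
  {E' : Type*} [NormedAddCommGroup E'] [NormedSpace ℂ E']
  {N : Type*} [TopologicalSpace N] [ChartedSpace E' N]
  {E'' : Type*} [NormedAddCommGroup E''] [NormedSpace ℂ E'']
  {P : Type*} [TopologicalSpace P] [ChartedSpace E'' P] {k : ℕ}

theorem mfderiv_chartAt_symm_self (x : M) :
    mfderiv 𝓘(ℝ, E) 𝓘(ℝ, E) ((chartAt E x).symm : E → M) (chartAt E x x)
      = ContinuousLinearMap.id ℝ E := by
  refine HasMFDerivAt.mfderiv ⟨(chartAt E x).continuousAt_symm (mem_chart_target E x), ?_⟩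
  simp only [writtenInExtChartAt, extChartAt, mfld_simps]
  rw [(chartAt E x).left_inv (mem_chart_source E x)]
  refine HasFDerivAt.hasFDerivWithinAt ((hasFDerivAt_id _).congr_of_eventuallyEq ?_)
  filter_upwards [(chartAt E x).open_target.mem_nhds (mem_chart_target E x)] with z hz
  exact (chartAt E x).right_inv hz

namespace DiffForm

theorem pullback_pullback (α : DiffForm E M k) {f : N → M} {g : P → N} {y : P}
    (hf : MDifferentiableAt 𝓘(ℝ, E') 𝓘(ℝ, E) f (g y))
    (hg : MDifferentiableAt 𝓘(ℝ, E'') 𝓘(ℝ, E') g y) :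
    pullback (E := E') (E' := E'') g (pullback (E := E) (E' := E') f α) y
      = pullback (E := E) (E' := E'') (f ∘ g) α y := by
  simp only [pullback, mfderiv_comp y hf hg]
  rfl

theorem pullback_congr (α : DiffForm E M k) {f g : N → M} {y : N} (h : f =ᶠ[𝓝 y] g) :
    pullback (E' := E') f α y = pullback (E' := E') g α y := by
  simp only [pullback, h.mfderiv_eq, h.self_of_nhds]

theorem pullback_chartAt_symm_self (α : DiffForm E M k) (x : M) :
    α.pullback (E' := E) ((chartAt E x).symm : E → M) (chartAt E x x) = α x := by
  simp only [pullback, mfderiv_chartAt_symm_self]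
  rw [(chartAt E x).left_inv (mem_chart_source E x)]
  rfl

theorem d_congr {α β : DiffForm E M k} {x : M} (h : α =ᶠ[𝓝 x] β) : α.d x = β.d x := by
  have hsymm : Filter.Tendsto (chartAt E x).symm (𝓝 (chartAt E x x)) (𝓝 x) := by
    simpa using (chartAt E x).tendsto_symm (mem_chart_source E x)
  refine Filter.EventuallyEq.extDeriv_eq ?_
  filter_upwards [hsymm.eventually h] with z hz
  simp only [pullback, hz]

theorem d_pullback [IsManifold 𝓘(ℝ, E) 2 M] (α : DiffForm E' E' k) {f : M → E'} {x : M}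
    (hα : DifferentiableAt ℝ α (f x)) (hf : ContMDiffAt 𝓘(ℝ, E) 𝓘(ℝ, E') 2 f x) :
    (α.pullback f : DiffForm E M k).d x = pullback f (extDeriv α : DiffForm E' E' (k + 1)) x := by
  set φ := chartAt E x
  have hx : φ.symm (φ x) = x := φ.left_inv (mem_chart_source E x)
  have hsymm : ∀ z ∈ φ.target, ContMDiffAt 𝓘(ℝ, E) 𝓘(ℝ, E) 2 φ.symm z := fun z hz =>
    (contMDiffOn_chart_symm z hz).contMDiffAt (φ.open_target.mem_nhds hz)
  have hx_mem : φ x ∈ φ.target := mem_chart_target E x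
  have hfφ : ContMDiffAt 𝓘(ℝ, E) 𝓘(ℝ, E') 2 (f ∘ φ.symm) (φ x) :=
    ContMDiffAt.comp (φ x) (by rwa [hx]) (hsymm _ hx_mem)
  have hpull : ((α.pullback f : DiffForm E M k).pullback φ.symm : DiffForm E E k) =ᶠ[𝓝 (φ x)]
      fun z => (α ((f ∘ φ.symm) z)).compContinuousLinearMap (fderiv ℝ (f ∘ φ.symm) z) := by
    have hf_near : ∀ᶠ y in 𝓝 x, ContMDiffAt 𝓘(ℝ, E) 𝓘(ℝ, E') 2 f y :=
      (contMDiffAt_iff_contMDiffAt_nhds (by simp)).1 hf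
    rw [← hx] at hf_near
    filter_upwards [(φ.continuousAt_symm hx_mem).eventually hf_near,
      φ.open_target.mem_nhds hx_mem] with z hfz hz
    rw [pullback_pullback α (hfz.mdifferentiableAt two_ne_zero)
      ((hsymm z hz).mdifferentiableAt two_ne_zero), pullback, mfderiv_eq_fderiv]
  calc (α.pullback f : DiffForm E M k).d x
      = (extDeriv α ((f ∘ φ.symm) (φ x))).compContinuousLinearMap
          (fderiv ℝ (f ∘ φ.symm) (φ x)) := by
        rw [d, hpull.extDeriv_eq]
        exact extDeriv_pullback (by simpa [hx] using hα) hfφ.contDiffAt (by simp)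
    _ = (pullback f (extDeriv α : DiffForm E' E' (k + 1)) : DiffForm E M (k + 1)).pullback
          (E' := E) φ.symm (φ x) := by
        rw [pullback_pullback _ ((hx.symm ▸ hf : ContMDiffAt 𝓘(ℝ, E) 𝓘(ℝ, E') 2 f
          (φ.symm (φ x))).mdifferentiableAt two_ne_zero)
          ((hsymm _ hx_mem).mdifferentiableAt two_ne_zero), pullback, mfderiv_eq_fderiv]
    _ = pullback f (extDeriv α : DiffForm E' E' (k + 1)) x := pullback_chartAt_symm_self _ x

end DiffForm

theorem pullback_differential {f : N → M} {φ : M → ℝ} {y : N}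
    (hφ : MDifferentiableAt 𝓘(ℝ, E) 𝓘(ℝ, ℝ) φ (f y))
    (hf : MDifferentiableAt 𝓘(ℝ, E') 𝓘(ℝ, E) f y) :
    DiffForm.pullback (E := E) (E' := E') f (differential E φ) y = differential E' (φ ∘ f) y := by
  simp only [DiffForm.pullback, differential, mfderiv_comp y hφ hf]
  rfl

theorem differential_eq_iff {φ φ' : M → ℝ} {x : M} :
    differential E φ x = differential E φ' x ↔
      mfderiv 𝓘(ℝ, E) 𝓘(ℝ, ℝ) φ x = (mfderiv 𝓘(ℝ, E) 𝓘(ℝ, ℝ) φ' x : E →L[ℝ] ℝ) :=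
  (ContinuousAlternatingMap.ofSubsingleton ℝ E ℝ (0 : Fin 1)).injective.eq_iff

end Pullback

section Wedge

variable {E : Type*} [NormedAddCommGroup E] [NormedSpace ℝ E]
  {E' : Type*} [NormedAddCommGroup E'] [NormedSpace ℝ E'] {k : ℕ}

/-- The exterior product `τ ∧ α` of a covector and an alternating form, without normalising
factor. -/
def covectorWedge (τ : E →L[ℝ] ℝ) (α : E [⋀^Fin k]→L[ℝ] ℝ) : E [⋀^Fin (k + 1)]→L[ℝ] ℝ :=
  ContinuousAlternatingMap.alternatizeUncurryFin (τ.smulRight α)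

theorem covectorWedge_apply (τ : E →L[ℝ] ℝ) (α : E [⋀^Fin k]→L[ℝ] ℝ) (v : Fin (k + 1) → E) :
    covectorWedge τ α v = ∑ i : Fin (k + 1), (-1) ^ (i : ℕ) * (τ (v i) * α (i.removeNth v)) := by
  simp [covectorWedge, ContinuousAlternatingMap.alternatizeUncurryFin_apply]

theorem covectorWedge_apply_three (τ : E →L[ℝ] ℝ) (α : E [⋀^Fin 2]→L[ℝ] ℝ) (v₀ v₁ v₂ : E) :
    covectorWedge τ α ![v₀, v₁, v₂]
      = τ v₀ * α ![v₁, v₂] - τ v₁ * α ![v₀, v₂] + τ v₂ * α ![v₀, v₁] := by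
  have h₀ : (0 : Fin 3).removeNth ![v₀, v₁, v₂] = ![v₁, v₂] := by ext i; fin_cases i <;> rfl
  have h₁ : (1 : Fin 3).removeNth ![v₀, v₁, v₂] = ![v₀, v₂] := by ext i; fin_cases i <;> rfl
  have h₂ : (2 : Fin 3).removeNth ![v₀, v₁, v₂] = ![v₀, v₁] := by ext i; fin_cases i <;> rfl
  simp [covectorWedge_apply, Fin.sum_univ_three, h₀, h₁, h₂, ← sub_eq_add_neg]

theorem covectorWedge_compContinuousLinearMap (τ : E →L[ℝ] ℝ) (α : E [⋀^Fin k]→L[ℝ] ℝ)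
    (L : E' →L[ℝ] E) : (covectorWedge τ α).compContinuousLinearMap L
      = covectorWedge (τ.comp L) (α.compContinuousLinearMap L) := by
  ext v
  rw [ContinuousAlternatingMap.compContinuousLinearMap_apply, covectorWedge_apply,
    covectorWedge_apply]
  rfl

theorem extDeriv_smul_const {a : E → ℝ} {a' : E →L[ℝ] ℝ} {x : E} (ha : HasFDerivAt a a' x)
    (α : E [⋀^Fin k]→L[ℝ] ℝ) : extDeriv (fun y => a y • α) x = covectorWedge a' α := by
  rw [extDeriv, (ha.smul_const α).fderiv, covectorWedge]

end Wedge

section WedgeComplex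

variable {E : Type*} [NormedAddCommGroup E] [NormedSpace ℂ E]

theorem exists_ne_zero_apply_eq_zero_and_apply_I_smul_eq_zero (hE : 1 < Module.rank ℂ E)
    (τ : E →L[ℝ] ℝ) : ∃ w ≠ 0, τ w = 0 ∧ τ (Complex.I • w) = 0 := by
  let T : E →ₗ[ℂ] ℂ := StrongDual.extendRCLike (𝕜 := ℂ) τ
  have hT : ¬ Function.Injective T := fun hinj =>
    hE.not_ge (by simpa using LinearMap.lift_rank_le_of_injective T hinj)
  obtain ⟨w, hTw, hw⟩ : ∃ w, T w = 0 ∧ w ≠ 0 := by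
    simpa [injective_iff_map_eq_zero] using hT
  refine ⟨w, hw, ?_, ?_⟩
  · simpa [T, StrongDual.extendRCLike_apply] using congrArg Complex.re hTw
  · simpa [T, StrongDual.extendRCLike_apply] using congrArg Complex.im hTw

theorem covectorWedge_left_injective (hE : 1 < Module.rank ℂ E) {α : E [⋀^Fin 2]→L[ℝ] ℝ}
    (hα : ∀ w, w ≠ 0 → α ![w, Complex.I • w] ≠ 0) :
    Function.Injective fun τ : E →L[ℝ] ℝ => covectorWedge τ α := by
  intro τ τ' h
  obtain ⟨w, hw, hτw, hτIw⟩ :=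
    exists_ne_zero_apply_eq_zero_and_apply_I_smul_eq_zero hE (τ - τ')
  ext v
  have hv : covectorWedge τ α ![v, w, Complex.I • w] = covectorWedge τ' α ![v, w, Complex.I • w] :=
    congrArg (· ![v, w, Complex.I • w]) h
  rw [covectorWedge_apply_three, covectorWedge_apply_three] at hv
  rw [sub_apply, sub_eq_zero] at hτw hτIw
  rw [hτw, hτIw] at hv
  exact mul_right_cancel₀ (hα w hw) (by linarith)

end WedgeComplex

section Flat

variable {V : Type*} [NormedAddCommGroup V] [InnerProductSpace ℂ V]
  {E : Type*} [NormedAddCommGroup E] [NormedSpace ℂ E]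
  {M : Type*} [TopologicalSpace M] [ChartedSpace E M]

theorem flatForm_apply (v : Fin 2 → V) : flatForm V v = (inner ℂ (v 0) (v 1)).im := rfl

variable (V) in
/-- The primitive `d^c ‖z‖²` of the flat form on `V`: half the contraction of the flat form with
the radial vector field. -/
def flatPrimitive : V →L[ℝ] V [⋀^Fin 1]→L[ℝ] ℝ := (1 / 2 : ℝ) • (flatForm V).curryLeft

theorem flatPrimitive_apply (z : V) (v : Fin 1 → V) :
    flatPrimitive V z v = 1 / 2 * (inner ℂ z (v 0)).im := by
  simp [flatPrimitive, flatForm_apply]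

theorem extDeriv_flatPrimitive (z : V) : extDeriv (flatPrimitive V) z = flatForm V := by
  rw [extDeriv, ContinuousLinearMap.fderiv, flatPrimitive,
    ContinuousAlternatingMap.alternatizeUncurryFin_smul,
    ContinuousAlternatingMap.alternatizeUncurryFin_curryLeft]
  module

theorem hasFDerivAt_norm_sq (z : V) :
    HasFDerivAt (fun z : V => ‖z‖ ^ 2)
      ((2 : ℝ) • Complex.reCLM.comp ((innerSL ℂ z).restrictScalars ℝ)) z := by
  let _ : InnerProductSpace ℝ V := InnerProductSpace.complexToReal
  convert (hasStrictFDerivAt_norm_sq z).hasFDerivAt using 1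
  ext v
  simp [real_inner_eq_re_inner ℂ]

theorem contMDiff_norm_sq (n : WithTop ℕ∞) : ContMDiff 𝓘(ℝ, V) 𝓘(ℝ, ℝ) n fun z : V => ‖z‖ ^ 2 := by
  let _ : InnerProductSpace ℝ V := InnerProductSpace.complexToReal
  exact (contDiff_norm_sq ℝ).contMDiff

theorem dc_norm_sq {f : M → V} {y : M} (hf : MDifferentiableAt 𝓘(ℂ, E) 𝓘(ℂ, V) f y) :
    dc E (fun x => ‖f x‖ ^ 2) y = DiffForm.pullback f (flatPrimitive V : DiffForm V V 1) y := by
  have hf' := hasMFDerivAt_restrictScalars ℝ hf.hasMFDerivAt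
  have hnorm : mfderiv 𝓘(ℝ, E) 𝓘(ℝ, ℝ) (fun x => ‖f x‖ ^ 2) y = _ :=
    ((hasFDerivAt_norm_sq (f y)).hasMFDerivAt.comp y hf').mfderiv
  ext v
  rw [dc, differential, hnorm, DiffForm.pullback, hf'.mfderiv]
  have hdc (L : E →L[ℂ] V) : -(1 / 4) * (2 * (inner ℂ (f y) (L (Complex.I • v 0))).re)
      = flatPrimitive V (f y) fun i => L (v i) := by
    rw [flatPrimitive_apply, map_smul, inner_smul_right, Complex.I_mul_re]
    ring
  exact hdc _

theorem ddc_norm_sq [IsManifold 𝓘(ℂ, E) ω M] {f : M → V} {y : M}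
    (hf : ContMDiffAt 𝓘(ℂ, E) 𝓘(ℂ, V) ω f y) :
    ddc E (fun x => ‖f x‖ ^ 2) y = DiffForm.pullback f (fun _ : V => flatForm V) y := by
  have : IsManifold 𝓘(ℝ, E) 2 M :=
    isManifold_restrictScalars ℝ (IsManifold.of_le (n := ω) le_top : IsManifold 𝓘(ℂ, E) 2 M)
  have hdc : dc E (fun x => ‖f x‖ ^ 2) =ᶠ[𝓝 y]
      DiffForm.pullback f (flatPrimitive V : DiffForm V V 1) := by
    filter_upwards [(contMDiffAt_iff_contMDiffAt_nhds (by simp)).1 hf] with x hx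
    exact dc_norm_sq (hx.mdifferentiableAt (by simp))
  rw [ddc, DiffForm.d_congr hdc, DiffForm.d_pullback _ (flatPrimitive V).differentiableAt
    ((contMDiffAt_restrictScalars ℝ hf).of_le le_top), funext extDeriv_flatPrimitive]

variable (V) in
/-- The form `‖z‖⁻² ω₀`. On `V \ {0}` it is the pullback of the form `ω_H` of the Hopf manifold; its
value at `0` is a junk value. -/
def coneForm : DiffForm V V 2 := fun z => (‖z‖ ^ 2)⁻¹ • flatForm V

theorem hasFDerivAt_inv_norm_sq {z : V} (hz : z ≠ 0) :
    HasFDerivAt (fun z : V => (‖z‖ ^ 2)⁻¹)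
      ((‖z‖ ^ 2)⁻¹ • fderiv ℝ (fun z : V => -Real.log (‖z‖ ^ 2)) z) z := by
  have hz' : ‖z‖ ^ 2 ≠ 0 := pow_ne_zero 2 (norm_ne_zero_iff.2 hz)
  rw [((hasFDerivAt_norm_sq z).log hz').fun_neg.fderiv]
  refine ((hasDerivAt_inv hz').comp_hasFDerivAt z (hasFDerivAt_norm_sq z)).congr_fderiv ?_
  rw [sq (‖z‖ ^ 2), mul_inv]
  module

theorem differentiableAt_neg_log_norm_sq {z : V} (hz : z ≠ 0) :
    DifferentiableAt ℝ (fun z : V => -Real.log (‖z‖ ^ 2)) z :=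
  ((hasFDerivAt_norm_sq z).log (pow_ne_zero 2 (norm_ne_zero_iff.2 hz))).neg.differentiableAt

theorem extDeriv_coneForm {z : V} (hz : z ≠ 0) :
    extDeriv (coneForm V) z
      = covectorWedge (fderiv ℝ (fun z : V => -Real.log (‖z‖ ^ 2)) z) (coneForm V z) := by
  refine (extDeriv_smul_const (hasFDerivAt_inv_norm_sq hz) (flatForm V)).trans ?_
  ext v
  simp only [coneForm, covectorWedge_apply, smul_apply,
    ContinuousAlternatingMap.smul_apply, smul_eq_mul]
  exact Finset.sum_congr rfl fun i _ => by ring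

end Flat

section HopfLift

variable {V : Type*} [NormedAddCommGroup V] [InnerProductSpace ℂ V] {l : HopfParameter}
  {p : HopfManifold V l} {z z' : V}

theorem exists_isHopfLift (p : HopfManifold V l) : ∃ z, IsHopfLift z p :=
  let ⟨z, hz⟩ := Quotient.exists_rep p
  ⟨z, z.2, hz⟩

namespace IsHopfLift

theorem ne_zero (h : IsHopfLift z p) : z ≠ 0 := h.1

theorem exists_zpow_smul_eq (h : IsHopfLift z p) (h' : IsHopfLift z' p) :
    ∃ k : ℤ, z' = l.val ^ k • z :=
  let ⟨_, hp⟩ := h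
  let ⟨_, hp'⟩ := h'
  (hopfMk_eq_iff _ _).1 (hp.trans hp'.symm)

theorem zpow_smul (h : IsHopfLift z p) (k : ℤ) : IsHopfLift (l.val ^ k • z) p :=
  let ⟨hz, hp⟩ := h
  ⟨smul_ne_zero (zpow_ne_zero k l.ne_zero) hz, ((hopfMk_eq_iff _ _).2 ⟨k, rfl⟩).symm.trans hp⟩

theorem zpow_smul_injective (h : IsHopfLift z p) :
    Function.Injective fun k : ℤ => ‖l.val ^ k • z‖ := by
  intro k m hkm
  simp only [norm_smul, norm_zpow] at hkm
  exact zpow_right_injective₀ (norm_pos_iff.2 l.ne_zero) l.norm_ne_one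
    (mul_right_cancel₀ (norm_ne_zero_iff.2 h.ne_zero) hkm)

theorem eq_of_norm_eq (h : IsHopfLift z p) (h' : IsHopfLift z' p) (hn : ‖z‖ = ‖z'‖) : z = z' := by
  obtain ⟨k, rfl⟩ := h.exists_zpow_smul_eq h'
  have hk : (0 : ℤ) = k := h.zpow_smul_injective (by simpa using hn)
  simp [← hk]

end IsHopfLift

theorem exists_hopfChart_apply_eq (hz : IsHopfLift z p) :
    ∃ e : OpenPartialHomeomorph (HopfManifold V l) V, IsHopfChart e ∧ p ∈ e.source ∧ e p = z := by
  obtain ⟨e, hp, he⟩ := exists_hopfChart p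
  obtain ⟨k, rfl⟩ := (he p hp).exists_zpow_smul_eq hz
  exact ⟨e.transHomeomorph (Homeomorph.smulOfNeZero _ (zpow_ne_zero k l.ne_zero)),
    fun q hq => (he q hq).zpow_smul k, hp, rfl⟩

section LocalLift

variable {T : Type*} [TopologicalSpace T] {f : T → HopfManifold V l} {g g' : T → V} {t : T}

/-- Near `t`, the map `g` is a continuous lift of `f` to `V \ {0}`. -/
def IsLocalHopfLift (g : T → V) (f : T → HopfManifold V l) (t : T) : Prop :=
  ∀ᶠ s in 𝓝 t, ContinuousAt g s ∧ IsHopfLift (g s) (f s)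

theorem isLocalHopfLift_of_continuous (hg : Continuous g) (h : ∀ s, IsHopfLift (g s) (f s)) :
    IsLocalHopfLift g f t :=
  Filter.Eventually.of_forall fun s => ⟨hg.continuousAt, h s⟩

theorem isLocalHopfLift_comp_hopfChart {e : OpenPartialHomeomorph (HopfManifold V l) V}
    (he : IsHopfChart e) (hf : Continuous f) (ht : f t ∈ e.source) :
    IsLocalHopfLift (e ∘ f) f t := by
  filter_upwards [hf.continuousAt.eventually (e.open_source.mem_nhds ht)] with s hs
  exact ⟨(e.continuousAt hs).comp hf.continuousAt, he _ hs⟩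

theorem exists_isLocalHopfLift (hf : Continuous f) (hz : IsHopfLift z (f t)) :
    ∃ g : T → V, IsLocalHopfLift g f t ∧ g t = z :=
  let ⟨e, he, ht, hz⟩ := exists_hopfChart_apply_eq hz
  ⟨e ∘ f, isLocalHopfLift_comp_hopfChart he hf ht, hz⟩

namespace IsLocalHopfLift

theorem continuousAt (h : IsLocalHopfLift g f t) : ContinuousAt g t := h.self_of_nhds.1

theorem isHopfLift (h : IsLocalHopfLift g f t) : IsHopfLift (g t) (f t) := h.self_of_nhds.2

theorem eventually (h : IsLocalHopfLift g f t) : ∀ᶠ s in 𝓝 t, IsLocalHopfLift g f s :=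
  Filter.Eventually.eventually_nhds h

theorem zpow_smul (h : IsLocalHopfLift g f t) (k : ℤ) :
    IsLocalHopfLift (fun s => l.val ^ k • g s) f t := by
  filter_upwards [h] with s hs
  exact ⟨hs.1.const_smul _, hs.2.zpow_smul k⟩

theorem comp {S : Type*} [TopologicalSpace S] {π : S → T} {s : S} (h : IsLocalHopfLift g f (π s))
    (hπ : Continuous π) : IsLocalHopfLift (g ∘ π) (f ∘ π) s := by
  filter_upwards [hπ.continuousAt.eventually h] with r hr
  exact ⟨hr.1.comp hπ.continuousAt, hr.2⟩

theorem eventuallyEq (h : IsLocalHopfLift g f t) (h' : IsLocalHopfLift g' f t)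
    (heq : g t = g' t) : g =ᶠ[𝓝 t] g' := by
  obtain ⟨c, hc, hgap⟩ := exists_hopf_gap l
  have hg : ‖g t‖ ≠ 0 := norm_ne_zero_iff.2 h.isHopfLift.ne_zero
  have hratio : Filter.Tendsto (fun s => ‖g' s‖ / ‖g s‖) (𝓝 t) (𝓝 1) := by
    rw [← div_self hg]
    nth_rw 1 [heq]
    exact h'.continuousAt.norm.tendsto.div h.continuousAt.norm hg
  have hc2 : 1 < c ^ 2 := one_lt_pow₀ hc two_ne_zero
  filter_upwards [hratio.eventually (lt_mem_nhds (inv_lt_one_of_one_lt₀ hc2)),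
    hratio.eventually (gt_mem_nhds hc2), h, h'] with s hlow hupp hs hs'
  obtain ⟨m, hm⟩ := hs.2.exists_zpow_smul_eq hs'.2
  rw [hm, norm_smul, norm_zpow,
    mul_div_cancel_right₀ _ (norm_ne_zero_iff.2 hs.2.ne_zero)] at hlow hupp
  rw [hm, hgap m hlow hupp, zpow_zero, one_smul]

end IsLocalHopfLift

theorem exists_forall_eq_zpow_smul_of_isHopfLift [ConnectedSpace T] (hg : Continuous g)
    (hg' : Continuous g') (h : ∀ t, IsHopfLift (g t) (f t)) (h' : ∀ t, IsHopfLift (g' t) (f t)) :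
    ∃ k : ℤ, ∀ t, g' t = l.val ^ k • g t := by
  obtain ⟨t₀⟩ := ‹ConnectedSpace T›.toNonempty
  obtain ⟨k, hk⟩ := (h t₀).exists_zpow_smul_eq (h' t₀)
  refine ⟨k, fun t => ?_⟩
  have hclopen : IsClopen {t | g' t = l.val ^ k • g t} := by
    refine ⟨isClosed_eq hg' (hg.const_smul _), isOpen_iff_mem_nhds.2 fun t ht => ?_⟩
    exact (isLocalHopfLift_of_continuous hg' h').eventuallyEq
      ((isLocalHopfLift_of_continuous hg h).zpow_smul k) ht
  exact Set.eq_univ_iff_forall.1 (hclopen.eq_univ ⟨t₀, hk⟩) t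

end LocalLift

section Holomorphic

variable {E : Type*} [NormedAddCommGroup E] [NormedSpace ℂ E]
  {N : Type*} [TopologicalSpace N] [ChartedSpace E N] {G : N → HopfManifold V l} {g : N → V} {y : N}

theorem IsLocalHopfLift.contMDiffAt (h : IsLocalHopfLift g G y)
    (hG : ContMDiff 𝓘(ℂ, E) 𝓘(ℂ, V) ω G) : ContMDiffAt 𝓘(ℂ, E) 𝓘(ℂ, V) ω g y := by
  obtain ⟨e, he, hy, hey⟩ := exists_hopfChart_apply_eq h.isHopfLift
  have heG : ContMDiffAt 𝓘(ℂ, E) 𝓘(ℂ, V) ω (e ∘ G) y :=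
    ((contMDiffOn_of_mem_maximalAtlas (IsManifold.subset_maximalAtlas he)).contMDiffAt
      (e.open_source.mem_nhds hy)).comp y (hG y)
  exact heG.congr_of_eventuallyEq
    (h.eventuallyEq (isLocalHopfLift_comp_hopfChart he hG.continuous hy) hey.symm)

theorem IsLocalHopfLift.pullback_hopfForm (h : IsLocalHopfLift g G y)
    (hG : ContMDiff 𝓘(ℂ, E) 𝓘(ℂ, V) ω G) :
    DiffForm.pullback (E' := E) G (hopfForm V l) y = DiffForm.pullback g (coneForm V) y := by
  obtain ⟨e, he, hy, hey⟩ := exists_hopfChart_apply_eq h.isHopfLift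
  have hg_target : g y ∈ e.target := hey ▸ e.map_source hy
  have hGg : G =ᶠ[𝓝 y] e.symm ∘ g := by
    filter_upwards [hG.continuous.continuousAt.eventually (e.open_source.mem_nhds hy),
      h.eventuallyEq (isLocalHopfLift_comp_hopfChart he hG.continuous hy) hey.symm] with x hx hgx
    rw [Function.comp_apply, hgx, Function.comp_apply, e.left_inv hx]
  have hsymm : ContMDiffAt 𝓘(ℂ, V) 𝓘(ℂ, V) ω e.symm (g y) :=
    (contMDiffOn_symm_of_mem_maximalAtlas (IsManifold.subset_maximalAtlas he)).contMDiffAt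
      (e.open_target.mem_nhds hg_target)
  rw [DiffForm.pullback_congr _ hGg, ← DiffForm.pullback_pullback _
    ((contMDiffAt_restrictScalars ℝ hsymm).mdifferentiableAt (by simp))
    ((contMDiffAt_restrictScalars ℝ (h.contMDiffAt hG)).mdifferentiableAt (by simp)),
    DiffForm.pullback, hopfForm_pullback V l he hg_target]
  rfl

end Holomorphic

end HopfLift

section LocallyConstant

variable {E : Type*} [NormedAddCommGroup E] [NormedSpace ℝ E]
  {M : Type*} [TopologicalSpace M] [ChartedSpace E M] [IsManifold 𝓘(ℝ, E) 1 M]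
  {E' : Type*} [NormedAddCommGroup E'] [NormedSpace ℝ E']

theorem eventually_eq_of_hasMFDerivAt_zero {f : M → E'} {x : M}
    (h : ∀ᶠ y in 𝓝 x, HasMFDerivAt 𝓘(ℝ, E) 𝓘(ℝ, E') f y (0 : E →L[ℝ] E')) :
    ∀ᶠ y in 𝓝 x, f y = f x := by
  set φ := chartAt E x
  have hx_target : φ x ∈ φ.target := mem_chart_target E x
  have hx : φ.symm (φ x) = x := φ.left_inv (mem_chart_source E x)
  have hderiv : ∀ᶠ z in 𝓝 (φ x), HasFDerivAt (f ∘ φ.symm) (0 : E →L[ℝ] E') z := by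
    have h' : ∀ᶠ y in 𝓝 (φ.symm (φ x)),
        HasMFDerivAt 𝓘(ℝ, E) 𝓘(ℝ, E') f y (0 : E →L[ℝ] E') := by rwa [hx]
    filter_upwards [(φ.continuousAt_symm hx_target).eventually h',
      φ.open_target.mem_nhds hx_target] with z hfz hz
    have hφz := ((contMDiffOn_chart_symm (n := 1) (I := 𝓘(ℝ, E)) (x := x)).contMDiffAt
      (φ.open_target.mem_nhds hz)).mdifferentiableAt one_ne_zero
    exact (hfz.comp z hφz.hasMFDerivAt).hasFDerivAt.congr_fderiv
      (ContinuousLinearMap.zero_comp _)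
  obtain ⟨r, hr, hball⟩ := Metric.eventually_nhds_iff_ball.1 hderiv
  have hconst : ∀ᶠ z in 𝓝 (φ x), f (φ.symm z) = f (φ.symm (φ x)) := by
    filter_upwards [Metric.ball_mem_nhds _ hr] with z hz
    exact Metric.isOpen_ball.is_const_of_fderiv_eq_zero (𝕜 := ℝ) (f := f ∘ φ.symm)
      (convex_ball (φ x) r).isPreconnected
      (fun w hw => (hball w hw).differentiableAt.differentiableWithinAt)
      (fun w hw => (hball w hw).fderiv) hz (Metric.mem_ball_self hr)
  filter_upwards [(φ.continuousAt (mem_chart_source E x)).eventually hconst,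
    φ.open_source.mem_nhds (mem_chart_source E x)] with y hy hy_source
  rwa [φ.left_inv hy_source, hx] at hy

end LocallyConstant

section Lee

variable {V : Type*} [NormedAddCommGroup V] [InnerProductSpace ℂ V] {l : HopfParameter}
  {E : Type*} [NormedAddCommGroup E] [NormedSpace ℂ E]
  {M : Type*} [TopologicalSpace M] [ChartedSpace E M]
  {Ω : DiffForm E M 2} {θ : DiffForm E M 1} {F : M → HopfManifold V l} {f : M → V} {x : M}

theorem IsLCK.d_eq_covectorWedge (hΩ : IsLCK Ω θ) {τ : E →L[ℝ] ℝ}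
    (hτ : ContinuousAlternatingMap.ofSubsingleton ℝ E ℝ (0 : Fin 1) τ = θ x) :
    Ω.d x = covectorWedge τ (Ω x) := by
  ext v
  have hv : v = ![v 0, v 1, v 2] := by ext i; fin_cases i <;> rfl
  have hθ : ∀ w, θ x ![w] = τ w := fun w => by rw [← hτ]; rfl
  rw [hv, hΩ.d_form, covectorWedge_apply_three, hθ, hθ, hθ]

theorem IsLocalHopfLift.pullback_coneForm_eventuallyEq (h : IsLocalHopfLift f F x)
    (hF : IsLCKImmersion Ω F) : Ω =ᶠ[𝓝 x] DiffForm.pullback f (coneForm V) := by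
  filter_upwards [h.eventually] with y hy
  rw [← hF.pullback_eq, hy.pullback_hopfForm hF.holomorphic]

theorem hasMFDerivAt_neg_log_norm_sq (hf : MDifferentiableAt 𝓘(ℝ, E) 𝓘(ℝ, V) f x)
    (hx : f x ≠ 0) :
    HasMFDerivAt 𝓘(ℝ, E) 𝓘(ℝ, ℝ) (fun y => -Real.log (‖f y‖ ^ 2)) x
      ((fderiv ℝ (fun z : V => -Real.log (‖z‖ ^ 2)) (f x)).comp
        (mfderiv 𝓘(ℝ, E) 𝓘(ℝ, V) f x : E →L[ℝ] V) : E →L[ℝ] ℝ) :=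
  (differentiableAt_neg_log_norm_sq hx).hasFDerivAt.hasMFDerivAt.comp x hf.hasMFDerivAt

theorem IsLocalHopfLift.lee_eq_differential [IsManifold 𝓘(ℂ, E) ω M] (hE : 1 < Module.rank ℂ E)
    (hΩ : IsLCK Ω θ) (hF : IsLCKImmersion Ω F) (h : IsLocalHopfLift f F x) :
    θ x = differential E (fun y => -Real.log (‖f y‖ ^ 2)) x := by
  have : IsManifold 𝓘(ℝ, E) 2 M :=
    isManifold_restrictScalars ℝ (IsManifold.of_le (n := ω) le_top : IsManifold 𝓘(ℂ, E) 2 M)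
  have hf : ContMDiffAt 𝓘(ℝ, E) 𝓘(ℝ, V) 2 f x :=
    (contMDiffAt_restrictScalars ℝ (h.contMDiffAt hF.holomorphic)).of_le le_top
  have hx : f x ≠ 0 := h.isHopfLift.ne_zero
  have hΩf := h.pullback_coneForm_eventuallyEq hF
  have hlog := hasMFDerivAt_neg_log_norm_sq (hf.mdifferentiableAt two_ne_zero) hx
  obtain ⟨τ, hτ⟩ := (ContinuousAlternatingMap.ofSubsingleton ℝ E ℝ (0 : Fin 1)).surjective (θ x)
  have hdΩ : covectorWedge τ (Ω x) = covectorWedge (mfderiv 𝓘(ℝ, E) 𝓘(ℝ, ℝ)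
      (fun y => -Real.log (‖f y‖ ^ 2)) x : E →L[ℝ] ℝ) (Ω x) := by
    have hcone : DifferentiableAt ℝ (coneForm V) (f x) :=
      (hasFDerivAt_inv_norm_sq hx).differentiableAt.smul_const _
    rw [← hΩ.d_eq_covectorWedge hτ, DiffForm.d_congr hΩf, DiffForm.d_pullback _ hcone hf,
      DiffForm.pullback, extDeriv_coneForm hx, hΩf.self_of_nhds, hlog.mfderiv]
    exact covectorWedge_compContinuousLinearMap _ _ _
  rw [← hτ, covectorWedge_left_injective hE (fun w hw => (hΩ.pos x w hw).ne') hdΩ, differential]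

theorem IsLocalHopfLift.pullback_lee_eq_differential [IsManifold 𝓘(ℂ, E) ω M]
    {E' : Type*} [NormedAddCommGroup E'] [NormedSpace ℂ E']
    {N : Type*} [TopologicalSpace N] [ChartedSpace E' N] {π : N → M} {g : N → V} {y : N}
    (hE : 1 < Module.rank ℂ E) (hΩ : IsLCK Ω θ) (hF : IsLCKImmersion Ω F)
    (hπ : ContMDiff 𝓘(ℂ, E') 𝓘(ℂ, E) ω π) (h : IsLocalHopfLift g (F ∘ π) y) :
    DiffForm.pullback (E' := E') π θ y
      = differential E' (fun x => -Real.log (‖g x‖ ^ 2)) y := by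
  obtain ⟨f, hf, hfy⟩ := exists_isLocalHopfLift hF.holomorphic.continuous h.isHopfLift
  have hlog := hasMFDerivAt_neg_log_norm_sq ((contMDiffAt_restrictScalars ℝ
    (hf.contMDiffAt hF.holomorphic)).mdifferentiableAt (by simp)) hf.isHopfLift.ne_zero
  have hgf : g =ᶠ[𝓝 y] f ∘ π := h.eventuallyEq (hf.comp hπ.continuous) hfy.symm
  rw [DiffForm.pullback, hf.lee_eq_differential hE hΩ hF]
  refine (pullback_differential hlog.mdifferentiableAt
    ((contMDiff_restrictScalars ℝ hπ y).mdifferentiableAt (by simp))).trans ?_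
  refine differential_eq_iff.2 (Filter.EventuallyEq.mfderiv_eq ?_)
  filter_upwards [hgf] with x hx
  rw [Function.comp_apply, hx, Function.comp_apply]

end Lee

theorem IsHopfLift.exists_isHopfLift_and_iff {V : Type*} [NormedAddCommGroup V]
    [InnerProductSpace ℂ V] {l : HopfParameter} {p : HopfManifold V l} {w : V}
    (hw : IsHopfLift w p) {P : V → Prop} :
    (∃ z, IsHopfLift z p ∧ P z) ↔ ∃ k : ℤ, P (l.val ^ k • w) := by
  constructor
  · rintro ⟨z, hz, hPz⟩
    obtain ⟨k, rfl⟩ := hw.exists_zpow_smul_eq hz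
    exact ⟨k, hPz⟩
  · rintro ⟨k, hk⟩
    exact ⟨_, hw.zpow_smul k, hk⟩

namespace KahlerCovering

section Lift

variable {V : Type*} [NormedAddCommGroup V] [InnerProductSpace ℂ V] {l : HopfParameter}
  {E : Type*} [NormedAddCommGroup E] [NormedSpace ℂ E]
  {M : Type*} [TopologicalSpace M] [ChartedSpace E M] [IsManifold 𝓘(ℂ, E) ω M]
  {Ω : DiffForm E M 2} {θ : DiffForm E M 1} {F : M → HopfManifold V l}
  {K : KahlerCovering.{w} θ} {g : K.carrier → V} {y : K.carrier}

theorem hasMFDerivAt_pot (hE : 1 < Module.rank ℂ E) (hΩ : IsLCK Ω θ) (hF : IsLCKImmersion Ω F)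
    (h : IsLocalHopfLift g (F ∘ K.proj) y) :
    HasMFDerivAt 𝓘(ℝ, E) 𝓘(ℝ, ℝ) K.pot y
      (mfderiv 𝓘(ℝ, E) 𝓘(ℝ, ℝ) (fun x => -Real.log (‖g x‖ ^ 2)) y) := by
  have hdiff : differential E K.pot y = differential E (fun x => -Real.log (‖g x‖ ^ 2)) y := by
    rw [← K.d_pot]
    exact h.pullback_lee_eq_differential hE hΩ hF K.localDiffeo.contMDiff
  rw [← differential_eq_iff.1 hdiff]
  exact ((K.smooth_pot y).mdifferentiableAt (by simp)).hasMFDerivAt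

theorem eventually_exp_pot_mul_norm_sq_eq (hE : 1 < Module.rank ℂ E) (hΩ : IsLCK Ω θ)
    (hF : IsLCKImmersion Ω F) (h : IsLocalHopfLift g (F ∘ K.proj) y) :
    ∀ᶠ x in 𝓝 y, Real.exp (K.pot x) * ‖g x‖ ^ 2 = Real.exp (K.pot y) * ‖g y‖ ^ 2 := by
  have : IsManifold 𝓘(ℝ, E) 1 K.carrier := isManifold_restrictScalars ℝ
    (IsManifold.of_le (n := ω) le_top : IsManifold 𝓘(ℂ, E) 1 K.carrier)
  have hFπ := hF.holomorphic.comp K.localDiffeo.contMDiff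
  have hconst := eventually_eq_of_hasMFDerivAt_zero (E := E) (x := y)
    (f := K.pot - fun x => -Real.log (‖g x‖ ^ 2)) <| by
      filter_upwards [h.eventually] with x hx
      have hlog := hasMFDerivAt_neg_log_norm_sq ((contMDiffAt_restrictScalars ℝ
        (hx.contMDiffAt hFπ)).mdifferentiableAt (by simp)) hx.isHopfLift.ne_zero
      have hsub := (hasMFDerivAt_pot hE hΩ hF hx).sub hlog.mdifferentiableAt.hasMFDerivAt
      exact hsub.congr_mfderiv (sub_self (_ : E →L[ℝ] ℝ))
  have hexp : ∀ {x}, IsLocalHopfLift g (F ∘ K.proj) x →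
      Real.exp (K.pot x) * ‖g x‖ ^ 2 = Real.exp ((K.pot - fun x => -Real.log (‖g x‖ ^ 2)) x) :=
    fun hx => by
      rw [Pi.sub_apply, sub_neg_eq_add, Real.exp_add,
        Real.exp_log (pow_pos (norm_pos_iff.2 hx.isHopfLift.ne_zero) 2)]
  filter_upwards [hconst, h.eventually] with x hx hlx
  rw [hexp hlx, hexp h, hx]

theorem exists_isHopfLift_exp_pot_mul_norm_sq_eq (hE : 1 < Module.rank ℂ E) (hΩ : IsLCK Ω θ)
    (hF : IsLCKImmersion Ω F) {y₀ : K.carrier} {z₀ : V} (hz₀ : IsHopfLift z₀ (F (K.proj y₀)))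
    (y : K.carrier) : ∃ z, IsHopfLift z (F (K.proj y)) ∧
      Real.exp (K.pot y) * ‖z‖ ^ 2 = Real.exp (K.pot y₀) * ‖z₀‖ ^ 2 := by
  set c := Real.exp (K.pot y₀) * ‖z₀‖ ^ 2
  have hconst : IsLocallyConstant fun y =>
      ∃ z, IsHopfLift z (F (K.proj y)) ∧ Real.exp (K.pot y) * ‖z‖ ^ 2 = c := by
    refine (IsLocallyConstant.iff_eventually_eq _).2 fun y => ?_
    obtain ⟨z, hz⟩ := exists_isHopfLift (F (K.proj y))
    obtain ⟨g, hg, -⟩ := exists_isLocalHopfLift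
      (hF.holomorphic.continuous.comp K.covering.continuous) hz
    filter_upwards [hg, eventually_exp_pot_mul_norm_sq_eq hE hΩ hF hg] with x hgx hx
    rw [eq_iff_iff, IsHopfLift.exists_isHopfLift_and_iff (p := F (K.proj x)) hgx.2,
      IsHopfLift.exists_isHopfLift_and_iff (p := F (K.proj y)) hg.isHopfLift]
    simp only [norm_smul, mul_pow, mul_left_comm (Real.exp _), hx]
  rw [hconst.apply_eq_of_preconnectedSpace y y₀]
  exact ⟨z₀, hz₀, rfl⟩

theorem isHolomorphicLift_of_exp_pot_mul_norm_sq_eq (hE : 1 < Module.rank ℂ E) (hΩ : IsLCK Ω θ)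
    (hF : IsLCKImmersion Ω F) {F' : K.carrier → V} {c : ℝ}
    (hlift : ∀ y, IsHopfLift (F' y) (F (K.proj y)))
    (hc : ∀ y, Real.exp (K.pot y) * ‖F' y‖ ^ 2 = c) : K.IsHolomorphicLift F F' := by
  refine ⟨fun y => ?_, hlift⟩
  have hFπ := hF.holomorphic.comp K.localDiffeo.contMDiff
  obtain ⟨g, hg, hgy⟩ := exists_isLocalHopfLift (f := F ∘ K.proj) hFπ.continuous (hlift y)
  refine (hg.contMDiffAt hFπ).congr_of_eventuallyEq ?_
  filter_upwards [hg, eventually_exp_pot_mul_norm_sq_eq hE hΩ hF hg] with x hgx hx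
  refine (hlift x).eq_of_norm_eq hgx.2 ?_
  rw [hgy, hc, ← hc x] at hx
  exact ((pow_left_inj₀ (norm_nonneg _) (norm_nonneg _) two_ne_zero).1
    (mul_left_cancel₀ (Real.exp_ne_zero _) hx)).symm

theorem exists_isHolomorphicLift (hE : 1 < Module.rank ℂ E) (hΩ : IsLCK Ω θ)
    (hF : IsLCKImmersion Ω F) (K : KahlerCovering.{w} θ) :
    ∃ (F' : K.carrier → V) (c : ℝ), 0 < c ∧ K.IsHolomorphicLift F F' ∧
      ∀ y, c * ‖F' y‖ ^ 2 = Real.exp (-K.pot y) := by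
  obtain ⟨y₀⟩ := K.connected.toNonempty
  obtain ⟨z₀, hz₀⟩ := exists_isHopfLift (F (K.proj y₀))
  choose F' hlift hc using exists_isHopfLift_exp_pot_mul_norm_sq_eq hE hΩ hF hz₀
  have hpos : 0 < Real.exp (K.pot y₀) * ‖z₀‖ ^ 2 :=
    mul_pos (Real.exp_pos _) (pow_pos (norm_pos_iff.2 hz₀.ne_zero) 2)
  refine ⟨F', _, inv_pos.2 hpos, isHolomorphicLift_of_exp_pot_mul_norm_sq_eq hE hΩ hF hlift hc,
    fun y => ?_⟩
  rw [← hc y, mul_inv, mul_assoc, inv_mul_cancel₀, mul_one, Real.exp_neg]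
  exact pow_ne_zero 2 (norm_ne_zero_iff.2 (hlift y).ne_zero)

end Lift

end KahlerCovering

section LocalDiffeomorph

variable {𝕜 : Type*} [NontriviallyNormedField 𝕜]
  {E : Type*} [NormedAddCommGroup E] [NormedSpace 𝕜 E] {H : Type*} [TopologicalSpace H]
  {I : ModelWithCorners 𝕜 E H} {M : Type*} [TopologicalSpace M] [ChartedSpace H M]
  {E' : Type*} [NormedAddCommGroup E'] [NormedSpace 𝕜 E'] {H' : Type*} [TopologicalSpace H']
  {I' : ModelWithCorners 𝕜 E' H'} {N : Type*} [TopologicalSpace N] [ChartedSpace H' N]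
  {E'' : Type*} [NormedAddCommGroup E''] [NormedSpace 𝕜 E''] {H'' : Type*} [TopologicalSpace H'']
  {I'' : ModelWithCorners 𝕜 E'' H''} {P : Type*} [TopologicalSpace P] [ChartedSpace H'' P]
  {n : WithTop ℕ∞} {f : M → N} {g : P → M} {x : P}

theorem contMDiffAt_of_isLocalDiffeomorphAt_comp (hf : IsLocalDiffeomorphAt I I' n f (g x))
    (hg : ContinuousAt g x) (hfg : ContMDiffAt I'' I' n (f ∘ g) x) : ContMDiffAt I'' I n g x :=
  (hf.localInverse_contMDiffAt.comp x hfg).congr_of_eventuallyEq <| by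
    filter_upwards [hg.eventually hf.localInverse_eventuallyEq_left] with y hy
    exact hy.symm

end LocalDiffeomorph

section DdcAlgebra

variable {E : Type*} [NormedAddCommGroup E] [NormedSpace ℂ E]
  {M : Type*} [TopologicalSpace M] [ChartedSpace E M] {k : ℕ} {f g : M → ℝ} {x : M}

theorem DiffForm.d_const_smul (c : ℝ) (α : DiffForm E M k) (x : M) :
    DiffForm.d (fun y => c • α y) x = c • α.d x :=
  extDeriv_smul c (DiffForm.pullback (E' := E) ((chartAt E x).symm : E → M) α)

theorem dc_congr (h : f =ᶠ[𝓝 x] g) : dc E f =ᶠ[𝓝 x] dc E g := by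
  filter_upwards [h.eventuallyEq_nhds] with y hy
  rw [dc, dc, differential_eq_iff.2 hy.mfderiv_eq]

theorem ddc_congr (h : f =ᶠ[𝓝 x] g) : ddc E f x = ddc E g x :=
  DiffForm.d_congr (dc_congr h)

theorem dc_const_mul (c : ℝ) (hf : MDifferentiableAt 𝓘(ℝ, E) 𝓘(ℝ, ℝ) f x) :
    dc E (fun y => c * f y) x = c • dc E f x := by
  have hder : mfderiv 𝓘(ℝ, E) 𝓘(ℝ, ℝ) (fun y => c * f y) x
      = c • (mfderiv 𝓘(ℝ, E) 𝓘(ℝ, ℝ) f x : E →L[ℝ] ℝ) := const_smul_mfderiv hf c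
  ext v
  rw [dc, dc, differential, hder]
  exact mul_left_comm _ _ _

theorem ddc_const_mul (c : ℝ) (hf : ∀ᶠ y in 𝓝 x, MDifferentiableAt 𝓘(ℝ, E) 𝓘(ℝ, ℝ) f y) :
    ddc E (fun y => c * f y) x = c • ddc E f x :=
  (DiffForm.d_congr (E := E) (hf.mono fun _ => dc_const_mul c)).trans (DiffForm.d_const_smul c _ x)

end DdcAlgebra

section LocalMax

variable {E : Type*} [NormedAddCommGroup E] [NormedSpace ℂ E]
  {M : Type*} [TopologicalSpace M] [ChartedSpace E M] [IsManifold 𝓘(ℂ, E) ω M]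
  {V : Type*} [NormedAddCommGroup V] [InnerProductSpace ℂ V] {f : M → V} {y : M}

theorem ddc_norm_sq_eq_zero_of_isLocalMax (hf : ContMDiff 𝓘(ℂ, E) 𝓘(ℂ, V) ω f)
    (hmax : IsLocalMax (norm ∘ f) y) : ddc E (fun x => ‖f x‖ ^ 2) y = 0 := by
  have : IsManifold 𝓘(ℂ, E) 1 M := .of_le (n := ω) le_top
  have hconst : ∀ᶠ x in 𝓝 y, ‖f x‖ ^ 2 = ‖f y‖ ^ 2 :=
    (Complex.norm_eventually_eq_of_mdifferentiableAt_of_isLocalMax (I := 𝓘(ℂ, E))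
      (.of_forall fun x => (hf x).mdifferentiableAt (by simp)) hmax).mono fun x hx => by rw [hx]
  rw [ddc_congr hconst, ddc_norm_sq contMDiffAt_const, DiffForm.pullback, mfderiv_const]
  ext
  exact (flatForm V).map_coord_zero (m := 0) 0 rfl

end LocalMax

section LCK

variable {E : Type*} [NormedAddCommGroup E] [NormedSpace ℂ E]
  {M : Type*} [TopologicalSpace M] [ChartedSpace E M] {Ω : DiffForm E M 2} {θ : DiffForm E M 1}
  {N : Type*} [TopologicalSpace N] [ChartedSpace E N] {f : N → M} {y : N}

theorem IsLCK.pullback_ne_zero [Nontrivial E] (hΩ : IsLCK Ω θ)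
    (hf : IsLocalDiffeomorphAt 𝓘(ℂ, E) 𝓘(ℂ, E) ω f y) :
    DiffForm.pullback (E := E) (E' := E) f Ω y ≠ 0 := by
  obtain ⟨v, hv⟩ := exists_ne (0 : E)
  let f' : E ≃L[ℂ] E := hf.mfderivToContinuousLinearEquiv (by simp)
  have hf' : mfderiv 𝓘(ℝ, E) 𝓘(ℝ, E) f y = (f' : E →L[ℂ] E).restrictScalars ℝ :=
    (hasMFDerivAt_restrictScalars ℝ (hf.mdifferentiableAt (by simp)).hasMFDerivAt).mfderiv
  intro h
  have hzero : DiffForm.pullback (E := E) (E' := E) f Ω y ![v, Complex.I • v] = 0 :=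
    DFunLike.congr_fun h _
  simp only [DiffForm.pullback, hf'] at hzero
  have hpos := hΩ.pos (f y) (f' v) (f'.map_eq_zero_iff.not.2 hv)
  rw [← map_smul] at hpos
  refine hpos.ne' (Eq.trans (congrArg _ ?_) hzero)
  ext i
  fin_cases i <;> rfl

end LCK

section ProperMap

theorem weaklyLocallyCompactSpace_of_isLocalHomeomorph {X Y : Type*} [TopologicalSpace X]
    [TopologicalSpace Y] [LocallyCompactSpace Y] {f : X → Y} (hf : IsLocalHomeomorph f) :
    WeaklyLocallyCompactSpace X where
  exists_compact_mem_nhds x := by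
    obtain ⟨e, hx, -⟩ := hf x
    obtain ⟨D, hD, hDe, hDc⟩ := local_compact_nhds (e.open_target.mem_nhds (e.map_source hx))
    refine ⟨e.symm '' D, hDc.image_of_continuousOn (e.continuousOn_symm.mono hDe), ?_⟩
    exact e.symm_image_eq_source_inter_preimage hDe ▸
      Filter.inter_mem (e.open_source.mem_nhds hx) ((e.continuousAt hx).preimage_mem_nhds hD)

theorem exists_isCompact_image_eq_univ {X Y : Type*} [TopologicalSpace X]
    [WeaklyLocallyCompactSpace X] [TopologicalSpace Y] [CompactSpace Y] {f : X → Y}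
    (hf : IsOpenMap f) (hsurj : Function.Surjective f) :
    ∃ C : Set X, IsCompact C ∧ f '' C = Set.univ := by
  choose D hDc hD using fun x : X => exists_compact_mem_nhds x
  choose s hs using hsurj
  obtain ⟨t, ht⟩ := CompactSpace.elim_nhds_subcover (fun y => f '' D (s y)) fun y => by
    simpa only [hs] using hf.image_mem_nhds (hD (s y))
  refine ⟨⋃ y ∈ t, D (s y), t.isCompact_biUnion fun y _ => hDc _, ?_⟩
  rw [Set.image_iUnion₂, ← Set.top_eq_univ, ← ht]

open scoped Pointwise in
theorem isProperMap_of_map_eq_add {Γ X G : Type*} [TopologicalSpace X] [TopologicalSpace G]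
    [AddGroup G] [IsTopologicalAddGroup G] [T2Space G] [WeaklyLocallyCompactSpace G]
    {a : Γ → X → X} (ha : ∀ γ, Continuous (a γ)) {C : Set X} (hC : IsCompact C)
    (hCa : ∀ x, ∃ γ, ∃ z ∈ C, a γ z = x) {τ : Γ → G}
    (hτ : Filter.Tendsto τ Filter.cofinite (Filter.cocompact G)) {φ : X → G} (hφ : Continuous φ)
    (hφa : ∀ γ x, φ (a γ x) = τ γ + φ x) : IsProperMap φ := by
  refine isProperMap_iff_isCompact_preimage.2 ⟨hφ, fun Q hQ => ?_⟩
  have hfin : (τ ⁻¹' (Q - φ '' C)).Finite := by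
    simpa [sub_eq_add_neg] using hτ (hQ.add (hC.image hφ).neg).compl_mem_cocompact
  refine (hfin.isCompact_biUnion fun γ _ => hC.image (ha γ)).of_isClosed_subset
    (hQ.isClosed.preimage hφ) fun x hx => ?_
  obtain ⟨γ, z, hz, rfl⟩ := hCa x
  refine Set.mem_biUnion (x := γ) ?_ (Set.mem_image_of_mem _ hz)
  exact Set.mem_sub.2 ⟨φ (a γ z), hx, φ z, Set.mem_image_of_mem _ hz,
    by rw [hφa, add_sub_cancel_right]⟩

end ProperMap

section HopfCharacter

variable {l : HopfParameter} {G : Type*} [Group G] {κ : G →* Multiplicative ℤ}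

theorem coe_hopfCharacter (k : Multiplicative ℤ) :
    (hopfCharacter l k : ℝ) = ‖l.val ^ k.toAdd‖ ^ 2 := by
  simp only [hopfCharacter, zpowersHom_apply, Positive.coe_zpow, norm_zpow]
  rw [← zpow_natCast, ← zpow_natCast, ← zpow_mul, ← zpow_mul, mul_comm]

theorem log_hopfCharacter (k : Multiplicative ℤ) :
    Real.log (hopfCharacter l k) = k.toAdd • Real.log (‖l.val‖ ^ 2) := by
  rw [coe_hopfCharacter, norm_zpow, Real.log_pow, Real.log_pow, Real.log_zpow, zsmul_eq_mul,
    mul_left_comm]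

theorem HopfParameter.log_norm_sq_ne_zero (l : HopfParameter) : Real.log (‖l.val‖ ^ 2) ≠ 0 :=
  Real.log_ne_zero_of_pos_of_ne_one (pow_pos (norm_pos_iff.2 l.ne_zero) 2) fun h =>
    l.norm_ne_one ((pow_eq_one_iff_of_nonneg (norm_nonneg _) two_ne_zero).1 h)

theorem hopfCharacter_injective : Function.Injective (hopfCharacter l) := by
  intro k m hkm
  have hlog := congrArg (fun r => Real.log r.1) hkm
  simp only [log_hopfCharacter] at hlog
  exact smul_left_injective ℤ l.log_norm_sq_ne_zero hlog

theorem tendsto_log_hopfCharacter_comp (hκ : Function.Injective κ) :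
    Filter.Tendsto (fun g => Real.log ((hopfCharacter l).comp κ g)) Filter.cofinite
      (Filter.cocompact ℝ) := by
  simp only [MonoidHom.comp_apply, log_hopfCharacter]
  exact (Int.tendsto_zmultiplesHom_cofinite l.log_norm_sq_ne_zero).comp
    (Multiplicative.toAdd.injective.comp hκ).tendsto_cofinite

theorem rank_additive_eq_one {G : Type*} [CommGroup G] [IsMulTorsionFree G] [Nontrivial G]
    [IsCyclic G] : Module.rank ℤ (Additive G) = 1 := by
  obtain ⟨g, hg⟩ := IsCyclic.exists_generator (α := G)
  exact le_antisymm (rank_le_one (Additive.ofMul g) hg) (Cardinal.one_le_iff_pos.2 rank_pos)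

theorem rank_range_eq_one_of_le_range_hopfCharacter {χ : G →* {r : ℝ // 0 < r}}
    (hle : χ.range ≤ (hopfCharacter l).range) (hχ : χ ≠ 1) :
    Module.rank ℤ (Additive χ.range) = 1 := by
  have : IsCyclic (hopfCharacter l).range := isCyclic_of_surjective (hopfCharacter l).rangeRestrict
    (hopfCharacter l).rangeRestrict_surjective
  have : IsCyclic χ.range := Subgroup.isCyclic_of_le hle
  have : Nontrivial χ.range :=
    (Subgroup.nontrivial_iff_ne_bot _).2 (MonoidHom.range_eq_bot_iff.not.2 hχ)
  exact rank_additive_eq_one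

end HopfCharacter

namespace KahlerCovering

section Deck

variable {E : Type*} [NormedAddCommGroup E] [NormedSpace ℂ E]
  {M : Type*} [TopologicalSpace M] [ChartedSpace E M]
  {θ : DiffForm E M 1} {K : KahlerCovering.{w} θ} {Ω : DiffForm E M 2}
  {χ : K.Deck →* {r : ℝ // 0 < r}} {ψ : K.carrier → ℝ}

theorem contMDiff_deck (γ : K.Deck) : ContMDiff 𝓘(ℂ, E) 𝓘(ℂ, E) ω γ.1 := fun y =>
  contMDiffAt_of_isLocalDiffeomorphAt_comp (K.localDiffeo _) γ.1.continuous.continuousAt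
    ((K.localDiffeo.contMDiff y).congr_of_eventuallyEq (.of_forall γ.2))

theorem pullback_deck_pullback_proj (γ : K.Deck) {k : ℕ} (α : DiffForm E M k) (y : K.carrier) :
    DiffForm.pullback (E := E) (E' := E) γ.1 (DiffForm.pullback (E := E) (E' := E) K.proj α) y
      = DiffForm.pullback (E := E) (E' := E) K.proj α y := by
  rw [DiffForm.pullback_pullback α
    ((contMDiff_restrictScalars ℝ K.localDiffeo.contMDiff _).mdifferentiableAt (by simp))
    ((contMDiff_restrictScalars ℝ (contMDiff_deck γ) y).mdifferentiableAt (by simp))]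
  exact DiffForm.pullback_congr α (.of_forall γ.2)

theorem isHomothetyCharacter_of_exp_neg_pot
    (hχ : ∀ (γ : K.Deck) y, Real.exp (-K.pot (γ.1 y)) = χ γ * Real.exp (-K.pot y)) :
    K.IsHomothetyCharacter Ω χ := fun γ => funext fun y =>
  calc DiffForm.pullback (E := E) (E' := E) γ.1 (K.kahlerForm Ω) y
    _ = Real.exp (-K.pot (γ.1 y)) • DiffForm.pullback (E := E) (E' := E) γ.1
          (DiffForm.pullback (E := E) (E' := E) K.proj Ω) y := rfl
    _ = (χ γ : ℝ) • K.kahlerForm Ω y := by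
        rw [pullback_deck_pullback_proj, hχ, kahlerForm, smul_smul]

theorem exists_isCompact_forall_deck [CompactSpace M] [T2Space M] (K : KahlerCovering.{w} θ) :
    ∃ C : Set K.carrier, IsCompact C ∧ ∀ y, ∃ γ : K.Deck, ∃ z ∈ C, γ.1 z = y := by
  have := weaklyLocallyCompactSpace_of_isLocalHomeomorph K.covering.isLocalHomeomorph
  obtain ⟨C, hC, hCM⟩ :=
    exists_isCompact_image_eq_univ K.covering.isLocalHomeomorph.isOpenMap K.surjective
  refine ⟨C, hC, fun y => ?_⟩
  obtain ⟨z, hz, hzy⟩ : K.proj y ∈ K.proj '' C := hCM ▸ Set.mem_univ _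
  obtain ⟨γ, hγ, hγz⟩ := K.galois z y hzy
  exact ⟨⟨γ, hγ⟩, z, hz, hγz⟩

theorem IsAutomorphicPotential.isProperPotential [CompactSpace M] [T2Space M]
    (hψ : K.IsAutomorphicPotential Ω χ ψ)
    (hχ : Filter.Tendsto (fun γ => Real.log (χ γ)) Filter.cofinite (Filter.cocompact ℝ)) :
    K.IsProperPotential ψ := by
  obtain ⟨C, hC, hCK⟩ := K.exists_isCompact_forall_deck
  have hlog : IsProperMap fun y => Real.log (ψ y) :=
    isProperMap_of_map_eq_add (fun γ => γ.1.continuous) hC hCK hχ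
      (hψ.smooth.continuous.log fun y => (hψ.pos y).ne') fun γ y => by
        rw [hψ.automorphic, Real.log_mul (χ γ).2.ne' (hψ.pos y).ne']
  refine ⟨hψ.pos, ?_⟩
  have hexp : (fun y => ⟨ψ y, hψ.pos y⟩) =
      Real.expOrderIso.toHomeomorph ∘ fun y => Real.log (ψ y) :=
    funext fun y => Subtype.ext (Real.exp_log (hψ.pos y)).symm
  exact hexp ▸ Real.expOrderIso.toHomeomorph.isProperMap.comp hlog

end Deck

section Character

variable {V : Type*} [NormedAddCommGroup V] [InnerProductSpace ℂ V] {l : HopfParameter}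
  {E : Type*} [NormedAddCommGroup E] [NormedSpace ℂ E]
  {M : Type*} [TopologicalSpace M] [ChartedSpace E M]
  {θ : DiffForm E M 1} {K : KahlerCovering.{w} θ} {Ω : DiffForm E M 2} {F : M → HopfManifold V l}
  {F' : K.carrier → V} {κ : K.Deck →* Multiplicative ℤ}

variable (l) in
/-- The map `F'` to `V \ {0}` is equivariant for the homomorphism `κ` from the deck group to the
deck group `ℤ` of the Hopf manifold, whose element `k` acts as `l ^ k • id`. -/
def IsEquivariant (F' : K.carrier → V) (κ : K.Deck →* Multiplicative ℤ) : Prop :=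
  ∀ (γ : K.Deck) (y : K.carrier), F' (γ.1 y) = l.val ^ (κ γ).toAdd • F' y

theorem IsEquivariant.norm_sq (h : IsEquivariant l F' κ) (γ : K.Deck) (y : K.carrier) :
    ‖F' (γ.1 y)‖ ^ 2 = (hopfCharacter l).comp κ γ * ‖F' y‖ ^ 2 := by
  rw [h, norm_smul, mul_pow, MonoidHom.comp_apply, coe_hopfCharacter]

theorem IsHolomorphicLift.exists_zpow_smul_eq (hF' : K.IsHolomorphicLift F F') (γ : K.Deck) :
    ∃ k : ℤ, ∀ y, F' (γ.1 y) = l.val ^ k • F' y := by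
  refine exists_forall_eq_zpow_smul_of_isHopfLift hF'.holomorphic.continuous
    (hF'.holomorphic.continuous.comp γ.1.continuous) hF'.lift fun y => ?_
  simpa only [Function.comp_apply, show K.proj (γ.1 y) = K.proj y from γ.2 y]
    using hF'.lift (γ.1 y)

theorem IsHolomorphicLift.exists_isEquivariant (hF' : K.IsHolomorphicLift F F') :
    ∃ κ : K.Deck →* Multiplicative ℤ, IsEquivariant l F' κ := by
  choose k hk using hF'.exists_zpow_smul_eq
  obtain ⟨y₀⟩ := K.connected.toNonempty
  refine ⟨.mk' (fun γ => .ofAdd (k γ)) fun γ δ => ?_, hk⟩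
  have hmul : F' ((γ * δ).1 y₀) = l.val ^ (k γ + k δ) • F' y₀ := by
    rw [zpow_add₀ l.ne_zero, mul_smul, ← hk, ← hk]
    rfl
  rw [hk] at hmul
  exact congrArg Multiplicative.ofAdd ((hF'.lift y₀).zpow_smul_injective (congrArg norm hmul))

theorem IsHolomorphicLift.pullback_eq_ddc (hF' : K.IsHolomorphicLift F F')
    (hF : IsLCKImmersion Ω F) (y : K.carrier) :
    DiffForm.pullback (E := E) (E' := E) K.proj Ω y
      = (‖F' y‖ ^ 2)⁻¹ • ddc E (fun z => ‖F' z‖ ^ 2) y := by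
  have hlift : IsLocalHopfLift F' (F ∘ K.proj) y :=
    isLocalHopfLift_of_continuous hF'.holomorphic.continuous hF'.lift
  rw [ddc_norm_sq (hF'.holomorphic y), ← hF.pullback_eq, DiffForm.pullback_pullback _
    ((contMDiff_restrictScalars ℝ hF.holomorphic _).mdifferentiableAt (by simp))
    ((contMDiff_restrictScalars ℝ K.localDiffeo.contMDiff y).mdifferentiableAt (by simp))]
  exact hlift.pullback_hopfForm (hF.holomorphic.comp K.localDiffeo.contMDiff)

theorem IsHolomorphicLift.isAutomorphicPotential (hF' : K.IsHolomorphicLift F F')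
    (hF : IsLCKImmersion Ω F) (hκ : IsEquivariant l F' κ) {c : ℝ}
    (hpot : ∀ y, c * ‖F' y‖ ^ 2 = Real.exp (-K.pot y)) :
    K.IsAutomorphicPotential Ω ((hopfCharacter l).comp κ) fun y => c * ‖F' y‖ ^ 2 where
  smooth := by
    simp only [hpot]
    exact Real.contDiff_exp.contMDiff.comp K.smooth_pot.neg
  pos y := hpot y ▸ Real.exp_pos _
  ddc_eq := funext fun y => by
    have hnorm : ContMDiff 𝓘(ℝ, E) 𝓘(ℝ, ℝ) 1 fun y => ‖F' y‖ ^ 2 :=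
      (contMDiff_norm_sq 1).comp ((contMDiff_restrictScalars ℝ hF'.holomorphic).of_le le_top)
    rw [ddc_const_mul c (.of_forall fun z => (hnorm z).mdifferentiableAt one_ne_zero), kahlerForm,
      hF'.pullback_eq_ddc hF, ← hpot, smul_smul, mul_assoc, mul_inv_cancel₀, mul_one]
    exact pow_ne_zero 2 (norm_ne_zero_iff.2 (hF'.lift y).ne_zero)
  automorphic γ y := by rw [hκ.norm_sq, mul_left_comm]

theorem IsHolomorphicLift.ne_one_of_isEquivariant [Nontrivial E] [CompactSpace M]
    [T2Space M] (hF' : K.IsHolomorphicLift F F') (hΩ : IsLCK Ω θ)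
    (hF : IsLCKImmersion Ω F) (hκ : IsEquivariant l F' κ) : κ ≠ 1 := by
  rintro rfl
  obtain ⟨C, hC, hCK⟩ := K.exists_isCompact_forall_deck
  obtain ⟨y⟩ := K.connected.toNonempty
  obtain ⟨-, z, hz, -⟩ := hCK y
  obtain ⟨y₀, -, hmax⟩ := hC.exists_isMaxOn ⟨z, hz⟩ hF'.holomorphic.continuous.norm.continuousOn
  have hglobal : ∀ y, ‖F' y‖ ≤ ‖F' y₀‖ := fun y => by
    obtain ⟨γ, z, hz, rfl⟩ := hCK y
    simpa [hκ γ z] using hmax hz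
  refine hΩ.pullback_ne_zero (K.localDiffeo y₀) ?_
  rw [hF'.pullback_eq_ddc hF, ddc_norm_sq_eq_zero_of_isLocalMax hF'.holomorphic
    (.of_forall hglobal), smul_zero]

end Character

end KahlerCovering

section LocalHomeomorph

variable {H : Type*} [TopologicalSpace H] {M : Type*} [TopologicalSpace M] [ChartedSpace H M]
  {N : Type*} [TopologicalSpace N] {f : N → M}

/-- The charts that a local homeomorphism `f : N → M` induces on `N`: a restriction of `f` to an
open set on which it is injective, followed by a chart of `M`. -/
@[reducible] def chartedSpaceOfIsLocalHomeomorph (hf : IsLocalHomeomorph f) :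
    ChartedSpace H N where
  atlas := {c | ∃ φ : OpenPartialHomeomorph N M, Set.EqOn f φ φ.source ∧
    ∃ e ∈ atlas H M, c = φ.trans e}
  chartAt y := (hf y).choose.trans (chartAt H (f y))
  mem_chart_source y := by
    obtain ⟨hy, hfy⟩ := (hf y).choose_spec
    rw [OpenPartialHomeomorph.trans_source, Set.mem_inter_iff, Set.mem_preimage, ← hfy]
    exact ⟨hy, mem_chart_source H (f y)⟩
  chart_mem_atlas y :=
    ⟨_, fun _ _ => congrFun (hf y).choose_spec.2 _, _, chart_mem_atlas H (f y), rfl⟩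

theorem hasGroupoid_of_isLocalHomeomorph (hf : IsLocalHomeomorph f) (G : StructureGroupoid H)
    [ClosedUnderRestriction G] [HasGroupoid M G] :
    letI := chartedSpaceOfIsLocalHomeomorph (H := H) hf
    HasGroupoid N G := by
  let _ := chartedSpaceOfIsLocalHomeomorph (H := H) hf
  refine ⟨?_⟩
  rintro _ _ ⟨φ, hφ, e, he, rfl⟩ ⟨φ', hφ', e', he', rfl⟩
  have htransition : ∀ q ∈ ((φ.trans e).symm.trans (φ'.trans e')).source,
      φ' (φ.symm (e.symm q)) = e.symm q := by
    rintro q ⟨⟨-, hqφ⟩, hqφ', -⟩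
    exact (hφ' hqφ').symm.trans ((hφ (φ.map_target hqφ)).trans (φ.right_inv hqφ))
  refine G.mem_of_eqOnSource (closedUnderRestriction' (G.compatible he he')
    ((φ.trans e).symm.trans (φ'.trans e')).open_source) ⟨?_, fun q hq => ?_⟩
  · refine (Set.inter_eq_right.2 fun q hq => ?_).symm.trans
      (OpenPartialHomeomorph.restr_source' _ _ (OpenPartialHomeomorph.open_source _)).symm
    exact ⟨hq.1.1, (congrArg (· ∈ e'.source) (htransition q hq)).mp hq.2.2⟩
  · exact congrArg e' (htransition q hq)

section Smooth

variable {𝕜 : Type*} [NontriviallyNormedField 𝕜] {E : Type*} [NormedAddCommGroup E]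
  [NormedSpace 𝕜 E] (I : ModelWithCorners 𝕜 E H) (n : WithTop ℕ∞) [IsManifold I n M]

theorem isManifold_of_isLocalHomeomorph (hf : IsLocalHomeomorph f) :
    letI := chartedSpaceOfIsLocalHomeomorph (H := H) hf
    IsManifold I n N :=
  letI := chartedSpaceOfIsLocalHomeomorph (H := H) hf
  { hasGroupoid_of_isLocalHomeomorph hf (contDiffGroupoid n I) with }

theorem trans_chartAt_mem_maximalAtlas (hf : IsLocalHomeomorph f) {φ : OpenPartialHomeomorph N M}
    (hφ : Set.EqOn f φ φ.source) (x : M) :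
    letI := chartedSpaceOfIsLocalHomeomorph (H := H) hf
    φ.trans (chartAt H x) ∈ IsManifold.maximalAtlas I n N :=
  letI := chartedSpaceOfIsLocalHomeomorph (H := H) hf
  have := isManifold_of_isLocalHomeomorph I n hf
  IsManifold.subset_maximalAtlas ⟨φ, hφ, _, chart_mem_atlas H x, rfl⟩

theorem contMDiffOn_of_eqOn_source (hf : IsLocalHomeomorph f) {φ : OpenPartialHomeomorph N M}
    (hφ : Set.EqOn f φ φ.source) :
    letI := chartedSpaceOfIsLocalHomeomorph (H := H) hf
    ContMDiffOn I I n φ φ.source := by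
  let _ := chartedSpaceOfIsLocalHomeomorph (H := H) hf
  have := isManifold_of_isLocalHomeomorph I n hf
  intro y hy
  set e := chartAt H (φ y)
  have hy_source : y ∈ (φ.trans e).source := ⟨hy, mem_chart_source H (φ y)⟩
  have he_symm : ContMDiffAt I I n e.symm ((φ.trans e) y) :=
    contMDiffOn_chart_symm.contMDiffAt (e.open_target.mem_nhds (mem_chart_target H (φ y)))
  refine ((he_symm.comp y (contMDiffAt_of_mem_maximalAtlas
    (trans_chartAt_mem_maximalAtlas I n hf hφ _) hy_source)).congr_of_eventuallyEq
    ?_).contMDiffWithinAt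
  filter_upwards [(φ.trans e).open_source.mem_nhds hy_source] with z hz
  exact (e.left_inv hz.2).symm

theorem contMDiffOn_symm_of_eqOn_source (hf : IsLocalHomeomorph f)
    {φ : OpenPartialHomeomorph N M} (hφ : Set.EqOn f φ φ.source) :
    letI := chartedSpaceOfIsLocalHomeomorph (H := H) hf
    ContMDiffOn I I n φ.symm φ.target := by
  let _ := chartedSpaceOfIsLocalHomeomorph (H := H) hf
  have := isManifold_of_isLocalHomeomorph I n hf
  intro x hx
  set e := chartAt H x
  have hx_source : x ∈ e.source := mem_chart_source H x
  have hx_target : e x ∈ (φ.trans e).target :=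
    ⟨mem_chart_target H x, by rwa [Set.mem_preimage, e.left_inv hx_source]⟩
  refine (((contMDiffAt_symm_of_mem_maximalAtlas (trans_chartAt_mem_maximalAtlas I n hf hφ x)
    hx_target).comp x (contMDiffOn_chart.contMDiffAt
    (e.open_source.mem_nhds hx_source))).congr_of_eventuallyEq ?_).contMDiffWithinAt
  filter_upwards [e.open_source.mem_nhds hx_source] with z hz
  exact congrArg φ.symm (e.left_inv hz).symm

theorem isLocalDiffeomorph_of_isLocalHomeomorph (hf : IsLocalHomeomorph f) :
    letI := chartedSpaceOfIsLocalHomeomorph (H := H) hf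
    IsLocalDiffeomorph I I n f := by
  let _ := chartedSpaceOfIsLocalHomeomorph (H := H) hf
  intro y
  obtain ⟨φ, hy, rfl⟩ := hf y
  exact ⟨⟨φ.toPartialEquiv, φ.open_source, φ.open_target,
    contMDiffOn_of_eqOn_source I n hf (Set.eqOn_refl _ _),
    contMDiffOn_symm_of_eqOn_source I n hf (Set.eqOn_refl _ _)⟩, hy, Set.eqOn_refl _ _⟩

end Smooth

end LocalHomeomorph

section QuotientCovering

open scoped Pointwise

variable {G X B : Type*} [Group G] [TopologicalSpace X] [MulAction G X]

theorem smul_connectedComponent_eq [ContinuousConstSMul G X] (g : G) (x : X) :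
    g • connectedComponent x = connectedComponent (g • x) := by
  have h := (Homeomorph.smul g).image_connectedComponentIn (Set.mem_univ x)
  rwa [Set.image_univ_of_surjective (Homeomorph.smul g).surjective, connectedComponentIn_univ,
    connectedComponentIn_univ] at h

variable [TopologicalSpace B] {f : X → B} [LocallyConnectedSpace X]

theorem surjective_domRestrict_connectedComponent [PreconnectedSpace B]
    (hf : IsQuotientCoveringMap f G) (p : X) :
    Function.Surjective ((connectedComponent p).domRestrict f) := by
  have := hf.toContinuousConstSMul
  have hopen : ∀ q, IsOpen (f '' connectedComponent q) := fun q =>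
    hf.isCoveringMap.isOpenMap _ isOpen_connectedComponent
  have hclopen : IsClopen (f '' connectedComponent p) := by
    refine ⟨⟨isOpen_iff_mem_nhds.2 fun x hx => ?_⟩, hopen p⟩
    obtain ⟨q, rfl⟩ := hf.surjective x
    refine Filter.mem_of_superset ((hopen q).mem_nhds ⟨q, mem_connectedComponent, rfl⟩) ?_
    rintro _ ⟨q', hq', rfl⟩ ⟨p', hp', hpq⟩
    obtain ⟨g, rfl⟩ := hf.apply_eq_iff_mem_orbit.1 hpq
    have hcomp : g • connectedComponent q = connectedComponent p := by
      rw [connectedComponent_eq hq', connectedComponent_eq hp', smul_connectedComponent_eq]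
    exact hx ⟨g • q, hcomp ▸ Set.smul_mem_smul_set mem_connectedComponent, hf.map_smul g⟩
  rw [← Set.range_eq_univ, Set.range_domRestrict]
  exact hclopen.eq_univ ⟨_, p, mem_connectedComponent, rfl⟩

theorem isQuotientCoveringMap_domRestrict_connectedComponent [PreconnectedSpace B]
    (hf : IsQuotientCoveringMap f G) (p : X) :
    IsQuotientCoveringMap ((connectedComponent p).domRestrict f)
      (MulAction.stabilizer G (connectedComponent p)) where
  toIsQuotientMap :=
    (hf.isCoveringMap.isOpenMap.comp isOpen_connectedComponent.isOpenMap_subtype_val).isQuotientMap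
      (hf.continuous.comp continuous_subtype_val) (surjective_domRestrict_connectedComponent hf p)
  continuous_const_smul g :=
    ((hf.continuous_const_smul g.1).comp continuous_subtype_val).subtype_mk _
  apply_eq_iff_mem_orbit {q q'} := by
    have := hf.toContinuousConstSMul
    refine ⟨fun h => ?_, fun ⟨g, hg⟩ => hg ▸ hf.map_smul g.1⟩
    obtain ⟨g, hg : g • q'.1 = q.1⟩ := hf.apply_eq_iff_mem_orbit.1 h
    have hstab : g • connectedComponent p = connectedComponent p :=
      calc g • connectedComponent p
        _ = g • connectedComponent q'.1 := congrArg _ (connectedComponent_eq q'.2)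
        _ = connectedComponent q.1 := by rw [smul_connectedComponent_eq, hg]
        _ = connectedComponent p := (connectedComponent_eq q.2).symm
    exact ⟨⟨g, hstab⟩, Subtype.ext hg⟩
  disjoint q := by
    obtain ⟨U, hU, hfree⟩ := hf.disjoint q.1
    refine ⟨_, preimage_coe_mem_nhds_subtype.2 (mem_nhdsWithin_of_mem_nhds hU), ?_⟩
    rintro g ⟨_, ⟨r, hr, rfl⟩, hr'⟩
    exact Subtype.ext (hfree g ⟨_, ⟨r, hr, rfl⟩, hr'⟩)

end QuotientCovering

section HopfPullback

variable {V : Type*} [NormedAddCommGroup V] [InnerProductSpace ℂ V] {l : HopfParameter}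
  {M : Type*}

/-- The pullback along `F` of the covering of the Hopf manifold by `V \ {0}`. -/
def HopfPullback (F : M → HopfManifold V l) : Type _ := {p : M × V // IsHopfLift p.2 (F p.1)}

namespace HopfPullback

variable {F : M → HopfManifold V l}

/-- The projection of the pullback to its base. -/
def base (p : HopfPullback F) : M := p.1.1

/-- The projection of the pullback to `V`, a lift of `F` to the total space of the covering. -/
def vec (p : HopfPullback F) : V := p.1.2

theorem isHopfLift_vec (p : HopfPullback F) : IsHopfLift p.vec (F p.base) := p.2

@[ext] theorem ext {p q : HopfPullback F} (hbase : p.base = q.base) (hvec : p.vec = q.vec) :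
    p = q :=
  Subtype.ext (Prod.ext hbase hvec)

instance : MulAction (Multiplicative ℤ) (HopfPullback F) where
  smul k p := ⟨(p.base, l.val ^ k.toAdd • p.vec), p.isHopfLift_vec.zpow_smul _⟩
  one_smul p := ext rfl ((congrArg (· • p.vec) (zpow_zero _)).trans (one_smul ℂ _))
  mul_smul k m p :=
    ext rfl ((congrArg (· • p.vec) (zpow_add₀ l.ne_zero k.toAdd m.toAdd)).trans (mul_smul _ _ _))

theorem base_smul (k : Multiplicative ℤ) (p : HopfPullback F) : (k • p).base = p.base := rfl

theorem vec_smul (k : Multiplicative ℤ) (p : HopfPullback F) :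
    (k • p).vec = l.val ^ k.toAdd • p.vec := rfl

theorem base_eq_iff_mem_orbit {p q : HopfPullback F} :
    p.base = q.base ↔ p ∈ MulAction.orbit (Multiplicative ℤ) q := by
  refine ⟨fun h => ?_, fun ⟨k, hk⟩ => hk ▸ base_smul k q⟩
  obtain ⟨k, hk⟩ := q.isHopfLift_vec.exists_zpow_smul_eq (h ▸ p.isHopfLift_vec)
  exact ⟨Multiplicative.ofAdd k, ext h.symm hk.symm⟩

theorem eq_one_of_vec_smul_eq {k : Multiplicative ℤ} {p : HopfPullback F}
    (h : (k • p).vec = p.vec) : k = 1 :=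
  p.isHopfLift_vec.zpow_smul_injective (a₁ := k.toAdd) (a₂ := 0) <| by
    simpa only [vec_smul, zpow_zero, one_smul] using congrArg norm h

variable [TopologicalSpace M]

instance : TopologicalSpace (HopfPullback F) :=
  inferInstanceAs (TopologicalSpace {p : M × V // IsHopfLift p.2 (F p.1)})

instance [T2Space M] : T2Space (HopfPullback F) :=
  inferInstanceAs (T2Space {p : M × V // IsHopfLift p.2 (F p.1)})

theorem continuous_base : Continuous (base : HopfPullback F → M) :=
  continuous_fst.comp continuous_subtype_val

theorem continuous_vec : Continuous (vec : HopfPullback F → V) :=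
  continuous_snd.comp continuous_subtype_val

theorem isOpenMap_base (hF : Continuous F) : IsOpenMap (base : HopfPullback F → M) := by
  refine isOpenMap_iff_nhds_le.2 fun p U hU => ?_
  obtain ⟨g, hg, hgp⟩ := exists_isLocalHopfLift hF p.isHopfLift_vec
  obtain ⟨W, hW, hWU⟩ := mem_nhds_subtype _ p _ |>.1 hU
  have hsection : Filter.Tendsto (fun x => (x, g x)) (𝓝 p.base) (𝓝 p.1) := by
    have h := Filter.tendsto_id.prodMk_nhds hg.continuousAt.tendsto
    rwa [hgp] at h
  filter_upwards [hsection.eventually hW, hg] with x hxW hgx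
  exact @hWU ⟨(x, g x), hgx.2⟩ hxW

theorem isQuotientCoveringMap_base (hF : Continuous F) :
    IsQuotientCoveringMap (base : HopfPullback F → M) (Multiplicative ℤ) where
  toIsQuotientMap := (isOpenMap_base hF).isQuotientMap continuous_base fun x =>
    let ⟨z, hz⟩ := exists_isHopfLift (F x)
    ⟨⟨(x, z), hz⟩, rfl⟩
  continuous_const_smul k :=
    (continuous_base.prodMk (continuous_vec.const_smul (l.val ^ k.toAdd))).subtype_mk _
  apply_eq_iff_mem_orbit := base_eq_iff_mem_orbit
  disjoint p := by
    obtain ⟨g, hg, hgp⟩ := exists_isLocalHopfLift hF p.isHopfLift_vec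
    have hvec : IsLocalHopfLift vec (F ∘ base) p :=
      isLocalHopfLift_of_continuous continuous_vec isHopfLift_vec
    refine ⟨_, hvec.eventuallyEq (hg.comp continuous_base) hgp.symm, ?_⟩
    rintro k ⟨_, ⟨q, hq, rfl⟩, hkq⟩
    exact eq_one_of_vec_smul_eq (hkq.trans hq.symm)

theorem locallyConnectedSpace {H : Type*} [TopologicalSpace H] [LocallyConnectedSpace H]
    [ChartedSpace H M] (hF : Continuous F) : LocallyConnectedSpace (HopfPullback F) :=
  let _ := chartedSpaceOfIsLocalHomeomorph (H := H)
    (isQuotientCoveringMap_base hF).isCoveringMap.isLocalHomeomorph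
  ChartedSpace.locallyConnectedSpace H _

end HopfPullback

end HopfPullback

theorem contMDiff_neg_log_norm_sq {V : Type*} [NormedAddCommGroup V] [InnerProductSpace ℂ V]
    {E : Type*} [NormedAddCommGroup E] [NormedSpace ℂ E] {M : Type*} [TopologicalSpace M]
    [ChartedSpace E M] {f : M → V} (hf : ContMDiff 𝓘(ℂ, E) 𝓘(ℂ, V) ω f)
    (hf0 : ∀ y, f y ≠ 0) :
    ContMDiff 𝓘(ℝ, E) 𝓘(ℝ, ℝ) ∞ fun y => -Real.log (‖f y‖ ^ 2) := fun y =>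
  ((Real.contDiffAt_log.2 (pow_ne_zero 2 (norm_ne_zero_iff.2 (hf0 y)))).contMDiffAt.comp y
    ((contMDiff_norm_sq ∞).comp ((contMDiff_restrictScalars ℝ hf).of_le le_top) y)).neg

namespace KahlerCovering

section Character

variable {V : Type*} [NormedAddCommGroup V] [InnerProductSpace ℂ V] {l : HopfParameter}
  {E : Type*} [NormedAddCommGroup E] [NormedSpace ℂ E]
  {M : Type*} [TopologicalSpace M] [ChartedSpace E M]
  {Ω : DiffForm E M 2} {θ : DiffForm E M 1} {F : M → HopfManifold V l}
  {K : KahlerCovering.{w} θ} {F' : K.carrier → V} {c : ℝ}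

theorem IsHolomorphicLift.exists_isHomothetyCharacter [Nontrivial E] [CompactSpace M]
    [T2Space M] (hΩ : IsLCK Ω θ) (hF : IsLCKImmersion Ω F)
    (hF' : K.IsHolomorphicLift F F') (hpot : ∀ y, c * ‖F' y‖ ^ 2 = Real.exp (-K.pot y)) :
    ∃ χ : K.Deck →* {r : ℝ // 0 < r}, K.IsHomothetyCharacter Ω χ ∧
      χ.range ≤ (hopfCharacter l).range ∧ lckRank χ = 1 ∧
      K.IsAutomorphicPotential Ω χ (fun y => c * ‖F' y‖ ^ 2) ∧
      (Function.Injective χ → K.IsProperPotential fun y => c * ‖F' y‖ ^ 2) := by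
  obtain ⟨κ, hκ⟩ := hF'.exists_isEquivariant
  have hψ := hF'.isAutomorphicPotential hF hκ hpot
  have hle : ((hopfCharacter l).comp κ).range ≤ (hopfCharacter l).range := by
    rintro _ ⟨γ, rfl⟩
    exact ⟨κ γ, rfl⟩
  have hne : (hopfCharacter l).comp κ ≠ 1 := fun h =>
    hF'.ne_one_of_isEquivariant hΩ hF hκ
      (MonoidHom.ext fun γ => hopfCharacter_injective
        ((DFunLike.congr_fun h γ).trans (map_one _).symm))
  refine ⟨_, isHomothetyCharacter_of_exp_neg_pot fun γ y => ?_, hle,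
    rank_range_eq_one_of_le_range_hopfCharacter hle hne, hψ, fun hinj =>
    hψ.isProperPotential (tendsto_log_hopfCharacter_comp
      (Function.Injective.of_comp (f := hopfCharacter l) hinj))⟩
  rw [← hpot, ← hpot, hψ.automorphic]

theorem IsHolomorphicLift.injective_of_isAutomorphicPotential
    {χ : K.Deck →* {r : ℝ // 0 < r}} (hF' : K.IsHolomorphicLift F F')
    (hψ : K.IsAutomorphicPotential Ω χ fun y => c * ‖F' y‖ ^ 2)
    (hfib : ∀ y y', K.proj y = K.proj y' → F' y = F' y' → y = y') : Function.Injective χ := by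
  refine (injective_iff_map_eq_one χ).2 fun γ hγ => Subtype.ext (Homeomorph.ext fun y => ?_)
  have hproj : K.proj (γ.1 y) = K.proj y := γ.2 y
  have hnorm : ‖F' (γ.1 y)‖ ^ 2 = ‖F' y‖ ^ 2 := by
    refine mul_left_cancel₀ (left_ne_zero_of_mul (hψ.pos y).ne') ?_
    rw [hψ.automorphic, hγ]
    exact one_mul _
  refine hfib _ _ hproj ((hproj ▸ hF'.lift (γ.1 y)).eq_of_norm_eq (hF'.lift y) ?_)
  exact (pow_left_inj₀ (norm_nonneg _) (norm_nonneg _) two_ne_zero).1 hnorm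

end Character

section Minimal

variable {V : Type t} [NormedAddCommGroup V] [InnerProductSpace ℂ V] {l : HopfParameter}
  {E : Type v} [NormedAddCommGroup E] [NormedSpace ℂ E]
  {M : Type u} [TopologicalSpace M] [ChartedSpace E M] [IsManifold 𝓘(ℂ, E) ω M]
  {Ω : DiffForm E M 2} {θ : DiffForm E M 1} {F : M → HopfManifold V l}

/-- The connected component of `p` in the pullback of `V \ {0}` along the lcK immersion `F`, as a
Kähler covering with `h = -log ‖z‖²` for the tautological lift `z` of `F`. As `z` separates the
points of every fibre, this is the minimal Kähler covering. -/
def ofHopfPullback [T2Space M] [ConnectedSpace M] (hE : 1 < Module.rank ℂ E) (hΩ : IsLCK Ω θ)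
    (hF : IsLCKImmersion Ω F) (p : HopfPullback F) : KahlerCovering.{max u t} θ :=
  have hFc := hF.holomorphic.continuous
  have := HopfPullback.locallyConnectedSpace (H := E) hFc
  have hq := isQuotientCoveringMap_domRestrict_connectedComponent
    (HopfPullback.isQuotientCoveringMap_base hFc) p
  have := hq.toContinuousConstSMul
  have hloc := hq.isCoveringMap.isLocalHomeomorph
  let _ := chartedSpaceOfIsLocalHomeomorph (H := E) hloc
  have hdiffeo := isLocalDiffeomorph_of_isLocalHomeomorph 𝓘(ℂ, E) ω hloc
  have hvec : ∀ q : connectedComponent p, IsLocalHopfLift (fun q => q.1.vec)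
      (F ∘ (connectedComponent p).domRestrict HopfPullback.base) q := fun _ =>
    isLocalHopfLift_of_continuous (HopfPullback.continuous_vec.comp continuous_subtype_val)
      fun q => q.1.isHopfLift_vec
  { carrier := connectedComponent p
    manifold := isManifold_of_isLocalHomeomorph 𝓘(ℂ, E) ω hloc
    connected := isConnected_iff_connectedSpace.1 isConnected_connectedComponent
    proj := (connectedComponent p).domRestrict HopfPullback.base
    covering := hq.isCoveringMap
    surjective := hq.surjective
    localDiffeo := hdiffeo
    galois := fun _ _ h =>
      let ⟨k, hk⟩ := hq.apply_eq_iff_mem_orbit.1 h.symm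
      ⟨Homeomorph.smul k, fun _ => hq.map_smul k, hk⟩
    pot := fun q => -Real.log (‖q.1.vec‖ ^ 2)
    smooth_pot := contMDiff_neg_log_norm_sq
      (fun q => (hvec q).contMDiffAt (hF.holomorphic.comp hdiffeo.contMDiff))
      fun q => q.1.isHopfLift_vec.ne_zero
    d_pot := funext fun q => (hvec q).pullback_lee_eq_differential hE hΩ hF hdiffeo.contMDiff }

theorem exists_isHolomorphicLift_injOn_fibers [T2Space M] [ConnectedSpace M]
    (hE : 1 < Module.rank ℂ E) (hΩ : IsLCK Ω θ) (hF : IsLCKImmersion Ω F) :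
    ∃ (K : KahlerCovering.{max u t} θ) (F' : K.carrier → V), K.IsHolomorphicLift F F' ∧
      (∀ y, ‖F' y‖ ^ 2 = Real.exp (-K.pot y)) ∧
      ∀ y y', K.proj y = K.proj y' → F' y = F' y' → y = y' := by
  obtain ⟨x⟩ := ‹ConnectedSpace M›.toNonempty
  obtain ⟨z, hz⟩ := exists_isHopfLift (F x)
  let K := ofHopfPullback hE hΩ hF ⟨(x, z), hz⟩
  let F' : K.carrier → V := fun q => q.1.vec
  have hlift : ∀ q : K.carrier, IsHopfLift (F' q) (F (K.proj q)) := fun q => q.1.isHopfLift_vec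
  have hnorm : ∀ q, ‖F' q‖ ^ 2 = Real.exp (-K.pot q) := fun q => by
    refine (Real.exp_log (pow_pos (norm_pos_iff.2 (hlift q).ne_zero) 2)).symm.trans ?_
    exact congrArg Real.exp (neg_neg _).symm
  refine ⟨K, F', isHolomorphicLift_of_exp_pot_mul_norm_sq_eq (c := 1) hE hΩ hF hlift fun q => ?_,
    hnorm, fun q q' hbase hvec => Subtype.ext (HopfPullback.ext hbase hvec)⟩
  rw [hnorm, ← Real.exp_add, add_neg_cancel, Real.exp_zero]

end Minimal

end KahlerCovering

end

theorem mainTheorem5_general {V : Type t} [NormedAddCommGroup V] [InnerProductSpace ℂ V]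
    {E : Type v} [NormedAddCommGroup E] [NormedSpace ℂ E] (hE : 1 < Module.rank ℂ E)
    {M : Type u} [TopologicalSpace M] [ChartedSpace E M] [IsManifold 𝓘(ℂ, E) ω M]
    [CompactSpace M] [T2Space M] [ConnectedSpace M]
    (Ω : DiffForm E M 2) (θ : DiffForm E M 1) (hΩ : IsLCK Ω θ)
    (l : HopfParameter) (F : M → HopfManifold V l) (hF : IsLCKImmersion Ω F) :
    (∃ (K : KahlerCovering.{max u t} θ) (χ : K.Deck →* {r : ℝ // 0 < r}) (F' : K.carrier → V),
      K.IsHomothetyCharacter Ω χ ∧ Function.Injective χ ∧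
      χ.range ≤ (hopfCharacter l).range ∧ KahlerCovering.lckRank χ = 1 ∧
      K.IsHolomorphicLift F F' ∧
      K.IsAutomorphicPotential Ω χ (fun y => ‖F' y‖ ^ 2) ∧
      K.IsProperPotential (fun y => ‖F' y‖ ^ 2)) ∧
    (∀ K : KahlerCovering.{w} θ,
      ∃ χ : K.Deck →* {r : ℝ // 0 < r}, K.IsHomothetyCharacter Ω χ ∧
        χ.range ≤ (hopfCharacter l).range ∧
        KahlerCovering.lckRank χ = 1 ∧
        ∃ (F' : K.carrier → V) (c : ℝ), 0 < c ∧
          K.IsHolomorphicLift F F' ∧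
          (∀ y, Ω.pullback K.proj y = (‖F' y‖ ^ 2)⁻¹ • ddc E (fun z => ‖F' z‖ ^ 2) y) ∧
          K.IsAutomorphicPotential Ω χ (fun y => c * ‖F' y‖ ^ 2) ∧
          (Function.Injective χ → K.IsProperPotential (fun y => c * ‖F' y‖ ^ 2))) := by
  have : Nontrivial E := rank_pos_iff_nontrivial.1 (zero_lt_one.trans hE)
  constructor
  · obtain ⟨K, F', hF', hpot, hfib⟩ :=
      KahlerCovering.exists_isHolomorphicLift_injOn_fibers hE hΩ hF
    obtain ⟨χ, hχ, hle, hrank, hψ, hproper⟩ :=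
      hF'.exists_isHomothetyCharacter hΩ hF (c := 1) (by simpa only [one_mul] using hpot)
    have hinj : Function.Injective χ := hF'.injective_of_isAutomorphicPotential hψ hfib
    simp only [one_mul] at hψ hproper
    exact ⟨K, χ, F', hχ, hinj, hle, hrank, hF', hψ, hproper hinj⟩
  · intro K
    obtain ⟨F', c, hc, hF', hpot⟩ := K.exists_isHolomorphicLift hE hΩ hF
    obtain ⟨χ, hχ, hle, hrank, hψ, hproper⟩ := hF'.exists_isHomothetyCharacter hΩ hF hpot
    exact ⟨χ, hχ, hle, hrank, F', c, hc, hF', hF'.pullback_eq_ddc hF, hψ, hproper⟩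

theorem mainTheorem5 {E : Type v} [NormedAddCommGroup E] [NormedSpace ℂ E]
    [FiniteDimensional ℂ E] (hdim : 2 ≤ Module.finrank ℂ E)
    {M : Type u} [TopologicalSpace M] [ChartedSpace E M] [IsManifold 𝓘(ℂ, E) ω M]
    [CompactSpace M] [T2Space M] [ConnectedSpace M]
    (Ω : DiffForm E M 2) (θ : DiffForm E M 1) (hΩ : IsLCK Ω θ)
    (l : HopfParameter) (F : M → HopfManifold (lp (fun _ : ℕ => ℂ) 2) l)
    (hF : IsLCKImmersion Ω F) :
    (∃ (K : KahlerCovering.{u} θ) (χ : K.Deck →* {r : ℝ // 0 < r})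
        (F' : K.carrier → lp (fun _ : ℕ => ℂ) 2),
      K.IsHomothetyCharacter Ω χ ∧ Function.Injective χ ∧
      χ.range ≤ (hopfCharacter l).range ∧ KahlerCovering.lckRank χ = 1 ∧
      K.IsHolomorphicLift F F' ∧
      K.IsAutomorphicPotential Ω χ (fun y => ‖F' y‖ ^ 2) ∧
      K.IsProperPotential (fun y => ‖F' y‖ ^ 2)) ∧
    (∀ K : KahlerCovering.{w} θ,
      ∃ χ : K.Deck →* {r : ℝ // 0 < r}, K.IsHomothetyCharacter Ω χ ∧
        χ.range ≤ (hopfCharacter l).range ∧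
        KahlerCovering.lckRank χ = 1 ∧
        ∃ (F' : K.carrier → lp (fun _ : ℕ => ℂ) 2) (c : ℝ), 0 < c ∧
          K.IsHolomorphicLift F F' ∧
          (∀ y, Ω.pullback K.proj y = (‖F' y‖ ^ 2)⁻¹ • ddc E (fun z => ‖F' z‖ ^ 2) y) ∧
          K.IsAutomorphicPotential Ω χ (fun y => c * ‖F' y‖ ^ 2) ∧
          (Function.Injective χ → K.IsProperPotential (fun y => c * ‖F' y‖ ^ 2))) :=
  mainTheorem5_general (Module.lt_rank_of_lt_finrank hdim) Ω θ hΩ l F hF
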